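/- Conventions. Sums and products are indexed by (small) sets. An abelian category $\mathsf A$ (with Hom sets) is *locally Noetherian* if it satisfies Ab5 and has a set of generators consisting of Noetherian objects. $\mathsf A_{\mathrm{inj}}$ denotes the full subcategory of injective objects of $\mathsf A$ and $\mathsf B_{\mathrm{proj}}$ the full subcategory of projective objects of $\mathsf B$. For a complete, separated topological ring $\mathfrak R$ in which the open right ideals form a base of neighborhoods of zero, let $\mathfrak R[[X]]$ be the set of all infinite formal linear combinations $\sum_{x\in X} r_x x$ whose family of coefficients converges to zero (for each neighborhood $U$ of zero, $r_x\in U$ for all but finitely many $x$). The functor $X\mapsto\mathfrak R[[X]]$ is a monad on the category of sets, with unit $x\mapsto 1\cdot x$ and multiplication given by opening the parentheses, $\sum_\alpha r_\alpha\bigl(\sum_x s_{\alpha,x}x\bigr)\mapsto\sum_x\bigl(\sum_\alpha r_\alpha s_{\alpha,x}\bigr)x$; a *left $\mathfrak R$-contramodule* is an algebra over this monad. **Theorem.** Let $\mathsf A$ be a locally Noetherian abelian category. 1. There exists an abelian category $\mathsf B$ with enough projectives such that the additive categories $\mathsf A_{\mathrm{inj}}$ and $\mathsf B_{\mathrm{proj}}$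 are (covariantly) equivalent. It is unique: if $\mathsf B_1,\mathsf B_2$ are abelian categories with enough projectives and $e_i\colon \mathsf A_{\mathrm{inj}}\simeq(\mathsf B_i)_{\mathrm{proj}}$ ($i=1,2$) are equivalences, then there is an additive equivalence $F\colon\mathsf B_1\simeq\mathsf B_2$ such that the functors $F\circ e_1$ and $e_2$ from $\mathsf A_{\mathrm{inj}}$ to $\mathsf B_2$ are isomorphic. 2. There exists an injective object $E\in\mathsf A$ such that every injective object of $\mathsf A$ is a direct summand of a direct sum of copies of $E$. For any such $E$, consider the ring $\mathfrak R=\operatorname{End}_{\mathsf A}(E)^{\mathrm{op}}$ with the topology in which a base of neighborhoods of zero is formed by the right ideals of $\mathfrak R$ opposite to the annihilators $\{f\in\operatorname{End}_{\mathsf A}(E): f|_M=0\}$ of the Noetherian subobjects $M\subset E$. Then $\mathfrak R$ is a complete, separated topological ring in which the open right ideals form a base of neighborhoods of zero, the category of left $\mathfrak R$-contramodules is abelian with enough projectives, and its full additive subcategory of projective objects is equivalent to $\mathsf A_{\mathrm{inj}}$. So one can take $\mathsf B$ to be the category of left $\mathfrak R$-contramodules. 3. All infinite direct sums and products exist in $\mathsf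 A$, and $\mathsf A_{\mathrm{inj}}$ is closed under both in $\mathsf A$. For any $\mathsf B$ as in 1, all infinite direct sums and products exist in $\mathsf B$, and $\mathsf B_{\mathrm{proj}}$ is closed under both in $\mathsf B$. -/

import Mathlib

open CategoryTheory Limits Filter Topology

universe v u v₁ u₁ v₂ u₂

/-- An abelian category is *locally Noetherian* if it satisfies Ab5 and has a (small) set of
generators consisting of Noetherian objects. -/
class IsLocallyNoetherian (A : Type u) [Category.{v} A] [Abelian A] : Prop where
  hasFilteredColimits : HasFilteredColimitsOfSize.{v, v} A
  ab5 : AB5OfSize.{v, v} A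
  exists_noetherian_generators : ∃ (ι : Type v) (G : ι → A),
    (∀ i, IsNoetherianObject (G i)) ∧ (ObjectProperty.ofObj G).IsSeparating

/-- The full subcategory of projective objects. -/
abbrev ProjectiveObject (B : Type u) [Category.{v} B] : Type u :=
  ObjectProperty.FullSubcategory (isProjective B)

/-- The object `E` is injective, and every injective object is a direct summand of a direct sum
of copies of `E`. -/
structure GeneratesInjectives {A : Type u} [Category.{v} A] (E : A) : Prop where
  injective : Injective E
  exists_retract (J : A) : Injective J → ∃ (X : Type v) (c : Cofan fun _ : X => E),
    Nonempty (IsColimit c) ∧ Nonempty (Retract J c.pt)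

section Rings

/-- The topological rings over which contramodules are considered: complete, separated
topological rings in which the open right ideals form a base of neighborhoods of zero. -/
class IsContraRing (R : Type*) [Ring R] [UniformSpace R] : Prop
    extends IsUniformAddGroup R, IsTopologicalRing R, T2Space R, CompleteSpace R,
      IsLinearTopology Rᵐᵒᵖ R

/-- The set `R[[X]]` of all infinite formal linear combinations of elements of `X` whose family of
coefficients converges to zero: for every neighborhood `U` of zero, all but finitely many
coefficients belong to `U`. -/
def ConvComb (R : Type*) [Ring R] [UniformSpace R] (X : Type*) : Type _ :=
  {f : X → R // Tendsto f cofinite (𝓝 0)}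

namespace ConvComb

variable {R : Type*} [Ring R] [UniformSpace R] {X Y Z W : Type*}

theorem mul_mem_rightIdeal {R : Type*} [Ring R] (N : Submodule Rᵐᵒᵖ R) {a : R} (ha : a ∈ N)
    (b : R) : a * b ∈ N :=
  N.smul_mem (MulOpposite.op b) ha

@[ext]
theorem ext {f g : ConvComb R X} (h : ∀ x, f.1 x = g.1 x) : f = g :=
  Subtype.ext (funext h)

open Classical in
/-- The formal linear combination `1 · x`. -/
noncomputable def single (x : X) : ConvComb R X :=
  ⟨fun y => if x = y then 1 else 0, by
    refine tendsto_nhds_of_eventually_eq ?_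
    refine (Set.finite_singleton x).subset fun y hy => ?_
    by_contra h
    exact hy (if_neg fun hxy => h hxy.symm)⟩

open Classical in
theorem single_apply (x y : X) : (single x : ConvComb R X).1 y = if x = y then 1 else 0 := rfl

variable [IsContraRing R]

theorem nonarchimedean : NonarchimedeanAddGroup R where
  is_nonarchimedean U hU := by
    obtain ⟨N, hN, hNU⟩ := (IsLinearTopology.hasBasis_open_submodule Rᵐᵒᵖ (M := R)).mem_iff.1 hU
    exact ⟨⟨N.toAddSubgroup, hN⟩, hNU⟩

theorem exists_rightIdeal {U : Set R} (hU : U ∈ 𝓝 (0 : R)) :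
    ∃ N : Submodule Rᵐᵒᵖ R, IsOpen (N : Set R) ∧ (N : Set R) ⊆ U :=
  (IsLinearTopology.hasBasis_open_submodule Rᵐᵒᵖ (M := R)).mem_iff.1 hU

theorem summable {f : X → R} (hf : Tendsto f cofinite (𝓝 0)) : Summable f :=
  haveI := nonarchimedean (R := R)
  NonarchimedeanAddGroup.summable_of_tendsto_cofinite_zero hf

/-- The double families obtained by opening parentheses converge to zero. -/
theorem tendsto_opening {f : X → R} (hf : Tendsto f cofinite (𝓝 0)) {k : X → Y → R}
    (hk : ∀ x, Tendsto (k x) cofinite (𝓝 0)) (c : X × Y → R) :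
    Tendsto (fun p : X × Y => f p.1 * k p.1 p.2 * c p) cofinite (𝓝 0) := by
  intro U hU
  obtain ⟨N, hN, hNU⟩ := exists_rightIdeal hU
  have hN0 : (N : Set R) ∈ 𝓝 (0 : R) := hN.mem_nhds N.zero_mem
  have h1 : {x | f x ∉ N}.Finite := hf hN0
  have h2 : ∀ x, {y | f x * k x y ∉ N}.Finite := fun x => by
    have : Tendsto (fun y => f x * k x y) cofinite (𝓝 0) := by
      simpa using (hk x).const_mul (f x)
    exact this hN0
  refine (h1.biUnion fun x _ => (h2 x).image (Prod.mk x)).subset ?_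
  rintro ⟨x, y⟩ hp
  have hxy : f x * k x y ∉ N := fun h => hp (hNU (mul_mem_rightIdeal N h _))
  exact Set.mem_biUnion (x := x) (fun h => hxy (mul_mem_rightIdeal N h _)) ⟨y, hxy, rfl⟩

theorem summable_fst {f : X → R} (hf : Tendsto f cofinite (𝓝 0)) {k : X → Y → R}
    (hk : ∀ x, Tendsto (k x) cofinite (𝓝 0)) (y : Y) : Summable fun x => f x * k x y := by
  have h := (tendsto_opening hf hk fun _ => 1).comp
    (Function.Injective.tendsto_cofinite (f := fun x : X => (x, y))
      fun _ _ h => (Prod.mk.inj h).1)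
  refine summable ?_
  simpa only [Function.comp_def, mul_one] using h

theorem summable_snd {g : Y → R} (hg : Tendsto g cofinite (𝓝 0)) (c : Y → R) :
    Summable fun y => g y * c y := by
  refine summable fun U hU => ?_
  obtain ⟨N, hN, hNU⟩ := exists_rightIdeal hU
  have h : {y | g y ∉ N}.Finite := hg (hN.mem_nhds N.zero_mem)
  exact h.subset fun y hy hyN => hy (hNU (mul_mem_rightIdeal N hyN _))

/-- Substituting the formal linear combinations `k x` for the elements `x` in `f = ∑ r_x x` and
opening the parentheses; the coefficient at `y` is the convergent sum `∑ r_x k_{x,y}` in `R`. -/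
noncomputable def bind (f : ConvComb R X) (k : X → ConvComb R Y) : ConvComb R Y :=
  ⟨fun y => ∑' x, f.1 x * (k x).1 y, by
    intro U hU
    obtain ⟨N, hN, hNU⟩ := exists_rightIdeal hU
    have hN0 : (N : Set R) ∈ 𝓝 (0 : R) := hN.mem_nhds N.zero_mem
    have hfin : {p : X × Y | f.1 p.1 * (k p.1).1 p.2 * 1 ∉ N}.Finite :=
      tendsto_opening f.2 (fun x => (k x).2) (fun _ => 1) hN0
    refine (hfin.image Prod.snd).subset fun y hy => ?_
    by_contra hcon
    refine hy (hNU ?_)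
    have hcl : IsClosed (N : Set R) := N.toAddSubgroup.isClosed_of_isOpen hN
    refine hcl.mem_of_tendsto (summable_fst f.2 (fun x => (k x).2) y).hasSum
      (Eventually.of_forall fun s => ?_)
    · refine N.sum_mem fun x _ => ?_
      by_contra hx
      exact hcon ⟨(x, y), by simpa using hx, rfl⟩⟩

theorem bind_apply (f : ConvComb R X) (k : X → ConvComb R Y) (y : Y) :
    (bind f k).1 y = ∑' x, f.1 x * (k x).1 y := rfl

theorem single_bind (x : X) (k : X → ConvComb R Y) : bind (single x) k = k x := by
  ext y
  rw [bind_apply, tsum_eq_single x]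
  · simp [single_apply]
  · intro x' hx'
    simp [single_apply, hx'.symm]

theorem bind_single (f : ConvComb R X) : bind f single = f := by
  ext y
  rw [bind_apply, tsum_eq_single y]
  · simp [single_apply]
  · intro x' hx'
    simp [single_apply, hx']

theorem bind_assoc (f : ConvComb R X) (k : X → ConvComb R Y) (l : Y → ConvComb R Z) :
    bind (bind f k) l = bind f fun x => bind (k x) l := by
  ext z
  simp only [bind_apply]
  have hs : Summable (Function.uncurry fun x y => f.1 x * (k x).1 y * (l y).1 z) :=
    summable (tendsto_opening f.2 (fun x => (k x).2) fun p => (l p.2).1 z)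
  calc ∑' y, (∑' x, f.1 x * (k x).1 y) * (l y).1 z
      = ∑' y, ∑' x, f.1 x * (k x).1 y * (l y).1 z := by
        refine tsum_congr fun y => ?_
        exact ((summable_fst f.2 (fun x => (k x).2) y).tsum_mul_right _).symm
    _ = ∑' x, ∑' y, f.1 x * (k x).1 y * (l y).1 z := hs.tsum_comm
    _ = ∑' x, f.1 x * ∑' y, (k x).1 y * (l y).1 z := by
        refine tsum_congr fun x => ?_
        simp only [mul_assoc]
        exact (summable_snd (k x).2 fun y => (l y).1 z).tsum_mul_left _

/-- The map `R[[X]] → R[[Y]]` induced by a map of sets `X → Y`, taking `∑ r_x x` to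
`∑ r_x g(x)`. -/
noncomputable def map (g : X → Y) (f : ConvComb R X) : ConvComb R Y :=
  bind f fun x => single (g x)

/-- The opening of parentheses `R[[R[[X]]]] → R[[X]]`. -/
noncomputable def flatten (F : ConvComb R (ConvComb R X)) : ConvComb R X :=
  bind F id

/-- The coefficient of the image at `y` is the sum of the coefficients over the fibre of `y`. -/
theorem map_apply (g : X → Y) (f : ConvComb R X) (y : Y) :
    (map g f).1 y = ∑' x : g ⁻¹' {y}, f.1 x := by
  classical
  rw [_root_.tsum_subtype (g ⁻¹' {y}) f.1]
  refine tsum_congr fun x => ?_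
  by_cases h : g x = y <;> simp [single_apply, Set.indicator, h]

theorem bind_map (g : X → Y) (f : ConvComb R X) (k : Y → ConvComb R Z) :
    bind (map g f) k = bind f fun x => k (g x) := by
  simp only [map, bind_assoc, single_bind]

theorem map_bind (f : ConvComb R X) (k : X → ConvComb R Y) (g : Y → Z) :
    map g (bind f k) = bind f fun x => map g (k x) := by
  simp only [map, bind_assoc]

end ConvComb

end Rings

/-- The monad `X ↦ R[[X]]` on the category of sets. -/
noncomputable def contraMonad (R : Type v) [Ring R] [UniformSpace R] [IsContraRing R] :
    Monad (Type v) where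
  obj X := ConvComb R X
  map g := ↾(ConvComb.map g)
  map_id X := by
    refine TypeCat.homEquiv.injective (funext fun f => ?_)
    exact ConvComb.bind_single f
  map_comp g h := by
    refine TypeCat.homEquiv.injective (funext fun f => ?_)
    exact (ConvComb.bind_map g f fun y => ConvComb.single (h y)).symm
  η := { app := fun X => ↾(ConvComb.single : X → ConvComb R X)
         naturality := fun X Y g => by
           refine TypeCat.homEquiv.injective (funext fun x => ?_)
           exact (ConvComb.single_bind x _).symm }
  μ := { app := fun X => ↾(ConvComb.flatten : ConvComb R (ConvComb R X) → ConvComb R X)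
         naturality := fun X Y g => by
           refine TypeCat.homEquiv.injective (funext fun F => ?_)
           exact (ConvComb.bind_map _ F id).trans (ConvComb.map_bind F id _).symm }
  assoc X := by
    refine TypeCat.homEquiv.injective (funext fun F => ?_)
    exact (ConvComb.bind_map _ F id).trans (ConvComb.bind_assoc F id id).symm
  left_unit X := by
    refine TypeCat.homEquiv.injective (funext fun f => ?_)
    exact ConvComb.single_bind f id
  right_unit X := by
    refine TypeCat.homEquiv.injective (funext fun f => ?_)
    exact (ConvComb.bind_map _ f id).trans (ConvComb.bind_single f)

/-- The category of left `R`-contramodules: algebras over the monad `X ↦ R[[X]]`. -/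
abbrev Contramodule (R : Type v) [Ring R] [UniformSpace R] [IsContraRing R] : Type (v + 1) :=
  (contraMonad R).Algebra

section EndOp

variable {A : Type u} [Category.{v} A] [Abelian A]

/-- The ring opposite to the ring of endomorphisms of `E`; multiplication in `End E` is the usual
composition of morphisms, `f * g = f ∘ g`. -/
def EndOp (E : A) : Type v := (End E)ᵐᵒᵖ

instance (E : A) : Ring (EndOp E) := inferInstanceAs (Ring (End E)ᵐᵒᵖ)

/-- The endomorphism of `E` corresponding to an element of `EndOp E`. -/
def EndOp.hom {E : A} (r : EndOp E) : E ⟶ E := MulOpposite.unop r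

/-- The restriction of endomorphisms of `E` to a subobject `M ⊆ E`. -/
noncomputable def EndOp.restrict {E : A} (M : Subobject E) (r : EndOp E) : (M : A) ⟶ E := M.arrow ≫ r.hom

/-- The topology on `EndOp E` generated by the cosets of the annihilators of Noetherian
subobjects of `E`, with its uniform structure: the coarsest one for which the restriction maps
`EndOp E → Hom(M, E)` to the discrete groups `Hom(M, E)` are uniformly continuous for all
Noetherian subobjects `M ⊆ E`. -/
noncomputable instance (E : A) : UniformSpace (EndOp E) :=
  ⨅ M : {M : Subobject E // IsNoetherianObject (M : A)},
    UniformSpace.comap (EndOp.restrict M.1) ⊥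

end EndOp

/-! Everything rests on one finiteness property: a morphism from a Noetherian object to a directed
union of subobjects factors through a member (`exists_factors_of_factors_iSup`), and so a morphism
to a coproduct factors through finitely many summands (`exists_finset_sum_comp_π_ι`). With Baer's
criterion, for which testing on Noetherian objects suffices, this makes coproducts of injectives
injective.

Let `E` be the coproduct of injective objects containing the quotients of the Noetherian generators.
Inside an injective `J`, a maximal independent family of subobjects that are retracts of `E` has an
injective sum, which splits off. A nonzero complement would contain a quotient of a generator
together with a maximal essential extension of it, again a retract of `E`, contradicting maximality.
Hence `J` is a summand of a sum of copies of `E`.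

Morphisms from `E` amount to compatible families of morphisms on its Noetherian subobjects
(`exists_glue`). This gives completeness of `EndOp E`, and also a meaning to infinite combinations
of morphisms `E ⟶ J` with coefficients tending to zero, since each is finite on every Noetherian
subobject. So `Hom(E, J)` is a contramodule. By the finiteness property, `Hom(E, ∐ E)` is the free
contramodule on the index set of the coproduct; thus `Hom(E, -)` is fully faithful on summands of
such coproducts, and idempotent splitting shows that all projective contramodules are reached.

For uniqueness, every object of an abelian category with enough projectives is the cokernel of a
morphism `f` between projectives, and its presheaf of morphisms from projectives depends only on
`f`. The restricted Yoneda embeddings of two candidates therefore have the same essential image.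
Presentations also produce the coproducts; products come from the contramodule model. -/

/-! ### Noetherian objects: quotients, extensions and finite sums -/

section Noetherian

variable {C : Type u} [Category.{v} C] [Abelian C]

theorem CategoryTheory.Subobject.factors_iff_comp_cokernel {X Y : C} (P : Subobject X) (f : Y ⟶ X) :
    P.Factors f ↔ f ≫ cokernel.π P.arrow = 0 := by
  refine ⟨fun h => ?_, fun h => ?_⟩
  · rw [← P.factorThru_arrow f h, Category.assoc, cokernel.condition, comp_zero]
  · rw [← Abelian.monoLift_comp P.arrow f h]
    exact Subobject.factors_comp_arrow _

theorem CategoryTheory.Subobject.factors_of_epi_comp {X Y Z : C} {P : Subobject X} (e : Z ⟶ Y)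
    [Epi e] {f : Y ⟶ X} (h : P.Factors (e ≫ f)) : P.Factors f := by
  rw [P.factors_iff_comp_cokernel] at h ⊢
  rwa [← cancel_epi e, comp_zero, ← Category.assoc]

/-- Pulling back along an epimorphism is injective on subobjects, because every subobject is
covered, after a refinement, by its preimage. Ascending chains in `Y` thus give ascending chains in
`X`. -/
theorem isNoetherianObject_of_epi {X Y : C} (p : X ⟶ Y) [Epi p] [IsNoetherianObject X] :
    IsNoetherianObject Y := by
  refine ⟨StrictMono.wellFoundedGT (f := fun P => (Subobject.pullback p).obj P) ?_⟩
  refine ((Subobject.pullback p).monotone).strictMono_of_injective fun P Q h => ?_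
  have key : ∀ P Q : Subobject Y, (Subobject.pullback p).obj P = (Subobject.pullback p).obj Q →
      P ≤ Q := fun P Q h => by
    obtain ⟨Z, e, _, x, hx⟩ := surjective_up_to_refinements_of_epi p P.arrow
    refine Subobject.le_of_factors (Subobject.factors_of_epi_comp e ?_)
    rw [hx, ← pullback_factors_iff, ← h, pullback_factors_iff, ← hx]
    exact Subobject.factors_comp_arrow _
  exact le_antisymm (key P Q h) (key Q P h.symm)

/-- The image of a morphism from a Noetherian object is Noetherian. -/
theorem isNoetherianObject_imageSubobject {X Y : C} (f : X ⟶ Y) [IsNoetherianObject X] :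
    IsNoetherianObject (imageSubobject f : C) :=
  isNoetherianObject_of_epi (factorThruImageSubobject f)

/-- For nested subobjects of `Y`, equality of the intersections with `X` and of the images in `Z`
forces equality, so the pair of these is a strictly monotone invariant. Surjectivity of `p` plays no
role. -/
theorem isNoetherianObject_of_shortExact {X Y Z : C} (i : X ⟶ Y) (p : Y ⟶ Z) [Mono i]
    (hp : ∀ {W : C} (f : W ⟶ Y), f ≫ p = 0 → ∃ g, g ≫ i = f) [IsNoetherianObject X]
    [IsNoetherianObject Z] : IsNoetherianObject Y := by
  refine ⟨StrictMono.wellFoundedGT (β := Subobject X × Subobject Z)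
    (f := fun P => ((Subobject.pullback i).obj P, imageSubobject (P.arrow ≫ p))) ?_⟩
  intro P Q hPQ
  refine lt_of_le_not_ge ⟨(Subobject.pullback i).monotone hPQ.le, ?_⟩ fun h => ?_
  · dsimp only
    rw [← Subobject.ofLE_arrow hPQ.le, Category.assoc]
    exact imageSubobject_comp_le _ _
  · refine hPQ.not_ge (Subobject.le_of_factors ?_)
    obtain ⟨h₁, h₂⟩ := h
    have hf : (imageSubobject (P.arrow ≫ p)).Factors (Q.arrow ≫ p) :=
      Subobject.factors_of_le _ h₂
        (by simpa using imageSubobject_factors_comp_self (Q.arrow ≫ p) (𝟙 _))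
    obtain ⟨W, e, _, x, hx⟩ := surjective_up_to_refinements_of_epi
      (factorThruImageSubobject (P.arrow ≫ p)) (Subobject.factorThru _ _ hf)
    have hx' : e ≫ Q.arrow ≫ p = x ≫ P.arrow ≫ p := by
      have := congrArg (· ≫ (imageSubobject (P.arrow ≫ p)).arrow) hx
      simpa using this
    obtain ⟨g, hg⟩ := hp (e ≫ Q.arrow - x ≫ P.arrow) (by simp [hx'])
    refine Subobject.factors_of_epi_comp e ?_
    have hgP : ((Subobject.pullback i).obj P).Factors g := by
      refine Subobject.factors_of_le _ h₁ ?_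
      rw [pullback_factors_iff, hg]
      have : e ≫ Q.arrow - x ≫ P.arrow = (e - x ≫ Subobject.ofLE P Q hPQ.le) ≫ Q.arrow := by simp
      rw [this]
      exact Subobject.factors_comp_arrow _
    rw [pullback_factors_iff, hg] at hgP
    have : e ≫ Q.arrow = (e ≫ Q.arrow - x ≫ P.arrow) + x ≫ P.arrow := by simp
    rw [this]
    exact Subobject.factors_add _ _ hgP (Subobject.factors_comp_arrow _)

theorem isNoetherianObject_biprod (X Y : C) [IsNoetherianObject X] [IsNoetherianObject Y] :
    IsNoetherianObject (X ⊞ Y) :=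
  isNoetherianObject_of_shortExact (biprod.inl : X ⟶ X ⊞ Y) biprod.snd fun f hf =>
    ⟨f ≫ biprod.fst, by ext <;> simp [hf]⟩

/-- Two Noetherian subobjects are contained in a Noetherian one. -/
theorem exists_isNoetherianObject_ge {X : C} (P Q : Subobject X) [IsNoetherianObject (P : C)]
    [IsNoetherianObject (Q : C)] :
    ∃ R : Subobject X, IsNoetherianObject (R : C) ∧ P ≤ R ∧ Q ≤ R := by
  have := isNoetherianObject_biprod (P : C) (Q : C)
  refine ⟨imageSubobject (biprod.desc P.arrow Q.arrow), isNoetherianObject_imageSubobject _,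
    Subobject.le_of_factors ?_, Subobject.le_of_factors ?_⟩
  · simpa using imageSubobject_factors_comp_self (biprod.desc P.arrow Q.arrow) biprod.inl
  · simpa using imageSubobject_factors_comp_self (biprod.desc P.arrow Q.arrow) biprod.inr

end Noetherian

/-! ### Noetherian objects and directed unions -/

section LocallyNoetherian

variable {A : Type u} [Category.{v} A] [Abelian A] [IsLocallyNoetherian A]

instance IsLocallyNoetherian.isGrothendieckAbelian : IsGrothendieckAbelian.{v} A := by
  have := IsLocallyNoetherian.hasFilteredColimits (A := A)
  have : HasColimitsOfSize.{v, v} A := has_colimits_of_finite_and_filtered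
  obtain ⟨ι, G, -, hG⟩ := IsLocallyNoetherian.exists_noetherian_generators (A := A)
  exact { hasFilteredColimitsOfSize := inferInstance
          ab5OfSize := IsLocallyNoetherian.ab5
          hasSeparator := ⟨∐ G, hG.isSeparator_coproduct⟩ }

theorem eq_zero_of_noetherian_comp_eq_zero {X Y : A} (f : X ⟶ Y)
    (h : ∀ (N : A) [IsNoetherianObject N] (g : N ⟶ X), g ≫ f = 0) : f = 0 := by
  obtain ⟨ι, G, hG, hsep⟩ := IsLocallyNoetherian.exists_noetherian_generators (A := A)
  refine hsep _ _ fun _ hi g => ?_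
  obtain ⟨i⟩ := hi
  have := hG i
  simpa using h (G i) g

theorem hom_ext_of_noetherian {X Y : A} {f f' : X ⟶ Y}
    (h : ∀ (N : A) [IsNoetherianObject N] (g : N ⟶ X), g ≫ f = g ≫ f') : f = f' :=
  sub_eq_zero.1 <| eq_zero_of_noetherian_comp_eq_zero _ fun N _ g => by
    rw [Preadditive.comp_sub, h, sub_self]

theorem mono_of_noetherian {X Y : A} (f : X ⟶ Y)
    (h : ∀ (N : A) [IsNoetherianObject N] (g : N ⟶ X), g ≫ f = 0 → g = 0) : Mono f :=
  Preadditive.mono_of_cancel_zero _ fun {Z} g hg => eq_zero_of_noetherian_comp_eq_zero _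
    fun N _ k => h N (k ≫ g) (by rw [Category.assoc, hg, comp_zero])

/-- A morphism from a Noetherian object to a directed union of subobjects factors through one of
them. -/
theorem exists_factors_of_factors_iSup {X N : A} [IsNoetherianObject N] (f : N ⟶ X)
    {J : Type v} [Preorder J] [IsDirectedOrder J] [Nonempty J] (s : J →o Subobject X)
    (h : (⨆ j, s j).Factors f) : ∃ j, (s j).Factors f := by
  -- It suffices that some composite `q j : N ⟶ X / s j` vanishes. The kernels of the `q j` increase
  -- with `j`, hence stabilize from some `j₀` on.
  let F : J ⥤ A :=
    { obj j := cokernel (s j).arrow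
      map {j k} φ := cokernel.desc _ (cokernel.π (s k).arrow)
        (by rw [← Subobject.ofLE_arrow (s.monotone (leOfHom φ)), Category.assoc,
          cokernel.condition, comp_zero]) }
  let q (j : J) : N ⟶ F.obj j := f ≫ cokernel.π (s j).arrow
  have hq {j k : J} (φ : j ⟶ k) : q j ≫ F.map φ = q k := by simp [q, F]
  obtain ⟨j₀, hj₀⟩ : ∃ j₀, ∀ j, j₀ ≤ j → kernelSubobject (q j) = kernelSubobject (q j₀) := by
    obtain ⟨m, ⟨j₀, rfl⟩, hm⟩ := WellFounded.has_min (wellFounded_gt (α := Subobject N))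
      (Set.range fun j => kernelSubobject (q j)) (Set.range_nonempty _)
    refine ⟨j₀, fun j hj => ?_⟩
    have hle : kernelSubobject (q j₀) ≤ kernelSubobject (q j) := by
      rw [← hq (homOfLE hj)]
      exact kernelSubobject_comp_le _ _
    by_contra hne
    exact hm _ ⟨j, rfl⟩ (lt_of_le_of_ne hle (Ne.symm hne))
  refine ⟨j₀, ?_⟩
  rw [Subobject.factors_iff_comp_cokernel]
  change q j₀ = 0
  -- The map from `X` to the colimit of the quotients is the same through every `j`. It kills each
  -- `s j`, hence their supremum, hence `N`.
  have hX : ∀ j, cokernel.π (s j).arrow ≫ colimit.ι F j =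
      cokernel.π (s j₀).arrow ≫ colimit.ι F j₀ := fun j => by
    obtain ⟨k, hjk, hk⟩ := exists_ge_ge j j₀
    rw [← colimit.w F (homOfLE hjk), ← colimit.w F (homOfLE hk)]
    simp [F]
  have h0 : q j₀ ≫ colimit.ι F j₀ = 0 := by
    have hle : (⨆ j, s j) ≤ kernelSubobject (cokernel.π (s j₀).arrow ≫ colimit.ι F j₀) :=
      iSup_le fun j => le_kernelSubobject _ _ (by rw [← hX j, cokernel.condition_assoc, zero_comp])
    have := (kernelSubobject_factors_iff _ _).1 (Subobject.factors_of_le f hle h)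
    simpa [q] using this
  let I := Abelian.image (q j₀)
  let U := Under j₀
  let φ : (Functor.const U).obj I ⟶ Under.forget j₀ ⋙ F :=
    { app j := Abelian.image.ι (q j₀) ≫ F.map j.hom
      naturality j k g := by
        dsimp
        rw [Category.id_comp, Category.assoc, ← F.map_comp, Under.w] }
  -- Since the kernels have stabilized, the image of `q j₀` embeds into every later quotient.
  -- Exactness of filtered colimits then embeds it into the colimit, where it becomes zero.
  have hφ : ∀ j, Mono (φ.app j) := fun j => by
    refine Preadditive.mono_of_cancel_zero _ fun {Z} g hg => ?_
    obtain ⟨W, e, _, x, hx⟩ := surjective_up_to_refinements_of_epi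
      (Abelian.factorThruImage (q j₀)) g
    have hfac : Abelian.factorThruImage (q j₀) ≫ φ.app j = q j.right := by
      dsimp only [φ]
      rw [← Category.assoc, Abelian.image.fac]
      exact hq j.hom
    have hxj : x ≫ q j.right = 0 := by
      have := congrArg (· ≫ φ.app j) hx
      rw [Category.assoc, hg, comp_zero, Category.assoc, hfac] at this
      exact this.symm
    have hxj₀ : x ≫ q j₀ = 0 := by
      rw [← kernelSubobject_factors_iff] at hxj ⊢
      rwa [← hj₀ _ (leOfHom j.hom)]
    rw [← cancel_epi e, comp_zero, hx, ← cancel_mono (Abelian.image.ι (q j₀)), zero_comp,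
      Category.assoc, Abelian.image.fac, hxj₀]
  have := NatTrans.mono_of_mono_app φ
  have : IsConnected U := IsFiltered.isConnected U
  have hmono : Mono (Abelian.image.ι (q j₀) ≫ colimit.ι F j₀) :=
    colim.map_mono' φ (isColimitConstCocone U I)
      ((Functor.Final.isColimitWhiskerEquiv (Under.forget j₀) _).symm (colimit.isColimit F)) _
      fun j => (Category.id_comp _).trans (by
        dsimp only [φ]
        rw [Category.assoc]
        exact congrArg _ (colimit.w F j.hom).symm)
  have hI : Abelian.image.ι (q j₀) = 0 := by
    have : Abelian.image.ι (q j₀) ≫ colimit.ι F j₀ = 0 := by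
      rw [← cancel_epi (Abelian.factorThruImage (q j₀)), ← Category.assoc, Abelian.image.fac, h0,
        comp_zero]
    have h1 : 𝟙 I = 0 := by
      rw [← cancel_mono (Abelian.image.ι (q j₀) ≫ colimit.ι F j₀), this, comp_zero, comp_zero]
    rw [← Category.id_comp (Abelian.image.ι (q j₀)), h1, zero_comp]
  rw [← Abelian.image.fac (q j₀), hI, comp_zero]

end LocallyNoetherian

/-! ### Morphisms from Noetherian objects to coproducts -/

section Coproducts

variable {A : Type u} [Category.{v} A] [Abelian A] [IsLocallyNoetherian A]

/-- A morphism from a Noetherian object to a coproduct factors through a finite subcoproduct. -/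
theorem exists_finset_sum_comp_π_ι {X : Type v} [DecidableEq X] (c : X → A) {N : A}
    [IsNoetherianObject N]
    (f : N ⟶ ∐ c) : ∃ F : Finset X, f = ∑ x ∈ F, (f ≫ Sigma.π c x) ≫ Sigma.ι c x := by
  let e (F : Finset X) : ∐ c ⟶ ∐ c := ∑ x ∈ F, Sigma.π c x ≫ Sigma.ι c x
  have hιe (F : Finset X) (x : X) : Sigma.ι c x ≫ e F = if x ∈ F then Sigma.ι c x else 0 := by
    simp only [e, Preadditive.comp_sum]
    split_ifs with hx
    · rw [Finset.sum_eq_single_of_mem x hx fun y _ hy => by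
        rw [Sigma.ι_π_of_ne_assoc _ hy.symm, zero_comp], Sigma.ι_π_eq_id_assoc]
    · exact Finset.sum_eq_zero fun y hy => by
        rw [Sigma.ι_π_of_ne_assoc _ (by rintro rfl; exact hx hy), zero_comp]
  -- `e F` is the projector onto the summands in `F`, so the kernel of `𝟙 - e F` is the finite
  -- subcoproduct. These form a directed family with union the whole coproduct.
  let s : Finset X →o Subobject (∐ c) :=
    ⟨fun F => kernelSubobject (𝟙 _ - e F), fun F F' h => le_kernelSubobject _ _ <| by
      have h1 : (kernelSubobject (𝟙 _ - e F)).arrow =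
          (kernelSubobject (𝟙 _ - e F)).arrow ≫ e F := by
        have := kernelSubobject_arrow_comp (𝟙 _ - e F)
        rw [Preadditive.comp_sub, Category.comp_id, sub_eq_zero] at this
        exact this
      have h2 : e F ≫ (𝟙 _ - e F') = 0 := by
        refine Sigma.hom_ext _ _ fun x => ?_
        rw [← Category.assoc, hιe, comp_zero]
        split_ifs with hx
        · rw [Preadditive.comp_sub, hιe, if_pos (h hx), Category.comp_id, sub_self]
        · exact zero_comp
      rw [h1, Category.assoc, h2, comp_zero]⟩
  have htop : (⨆ F, s F).Factors (𝟙 (∐ c)) := by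
    rw [Subobject.factors_iff_comp_cokernel]
    refine Sigma.hom_ext _ _ fun x => ?_
    rw [Category.id_comp, comp_zero, ← Subobject.factors_iff_comp_cokernel]
    refine Subobject.factors_of_le _ (le_iSup s {x}) ((kernelSubobject_factors_iff _ _).2 ?_)
    simp [Preadditive.comp_sub, hιe]
  obtain ⟨F, hF⟩ := exists_factors_of_factors_iSup f s
    (by simpa using Subobject.factors_of_factors_right f htop)
  refine ⟨F, ?_⟩
  have := (kernelSubobject_factors_iff _ _).1 hF
  rw [Preadditive.comp_sub, Category.comp_id, sub_eq_zero] at this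
  refine this.trans ?_
  simp [e, Preadditive.comp_sum]

/-- A morphism from a Noetherian object to the union of a directed set of subobjects factors
through one of them. -/
theorem exists_factors_of_factors_sSup {X N : A} [IsNoetherianObject N] (f : N ⟶ X)
    {S : Set (Subobject X)} (hS : S.Nonempty) (hd : DirectedOn (· ≤ ·) S)
    (h : (sSup S).Factors f) : ∃ P ∈ S, P.Factors f := by
  -- Subobjects of `X` form an essentially `v`-small set; the index type must be `v`-small for Ab5
  -- to apply.
  let o : Shrink.{v} S → Subobject X := fun j => ((equivShrink S).symm j).1
  let _ : Preorder (Shrink.{v} S) := Preorder.lift o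
  have : Nonempty (Shrink.{v} S) := hS.to_subtype.map (equivShrink S)
  have : IsDirectedOrder (Shrink.{v} S) := ⟨fun i j => by
    obtain ⟨k, hk, hik, hjk⟩ := hd _ ((equivShrink S).symm i).2 _ ((equivShrink S).symm j).2
    refine ⟨equivShrink S ⟨k, hk⟩, ?_, ?_⟩
    · change o i ≤ o _; simpa [o] using hik
    · change o j ≤ o _; simpa [o] using hjk⟩
  obtain ⟨j, hj⟩ := exists_factors_of_factors_iSup f ⟨o, fun i j hij => hij⟩
    (Subobject.factors_of_le f (sSup_le fun P hP => by
      refine le_trans (le_of_eq ?_) (le_iSup (fun j => o j) (equivShrink S ⟨P, hP⟩))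
      simp [o]) h)
  exact ⟨_, ((equivShrink S).symm j).2, hj⟩

end Coproducts

/-! ### Essential extensions, Baer's criterion and sums of injectives -/

section Essential

variable {A : Type u} [Category.{v} A] [Abelian A]

theorem CategoryTheory.Subobject.mk_factors_iff_exists {C : Type*} [Category* C] {X Y Z : C}
    {f : X ⟶ Y} [Mono f] {g : Z ⟶ Y} : (Subobject.mk f).Factors g ↔ ∃ b, b ≫ f = g :=
  Subobject.mk_factors_iff f g

theorem CategoryTheory.Subobject.disjoint_iff_forall_factors {X : A} {P Q : Subobject X} :
    Disjoint P Q ↔ ∀ ⦃Z : A⦄ (f : Z ⟶ X), P.Factors f → Q.Factors f → f = 0 := by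
  rw [disjoint_iff]
  refine ⟨fun h Z f hP hQ => ?_, fun h => ?_⟩
  · rw [← Subobject.bot_factors_iff_zero, ← h]
    exact (Subobject.inf_factors f).2 ⟨hP, hQ⟩
  · refine eq_bot_iff.2 (Subobject.le_of_factors ?_)
    rw [h _ (Subobject.inf_arrow_factors_left P Q) (Subobject.inf_arrow_factors_right P Q)]
    exact Subobject.factors_zero

/-- A morphism `j : X ⟶ Y` is essential if every nonzero morphism to `Y` meets `j`. -/
def IsEssentialHom {X Y : A} (j : X ⟶ Y) : Prop :=
  ∀ ⦃Z : A⦄ (d : Z ⟶ Y), (∀ ⦃W : A⦄ (a : W ⟶ Z) (b : W ⟶ X), a ≫ d = b ≫ j → a ≫ d = 0) → d = 0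

theorem IsEssentialHom.mono_of_mono_comp {X Y Z : A} {j : X ⟶ Y} (hj : IsEssentialHom j)
    (f : Y ⟶ Z) [Mono (j ≫ f)] : Mono f :=
  Preadditive.mono_of_cancel_zero _ fun g hg => hj g fun W a b hab => by
    have hb : b = 0 := by
      rw [← cancel_mono (j ≫ f), zero_comp, ← Category.assoc, ← hab, Category.assoc, hg, comp_zero]
    rw [hab, hb, zero_comp]

theorem IsEssentialHom.of_comp_mono {X Y Z : A} {j : X ⟶ Y} {f : Y ⟶ Z} [Mono f]
    (h : IsEssentialHom (j ≫ f)) : IsEssentialHom j := fun Z d hd => by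
  rw [← cancel_mono f, zero_comp]
  refine h _ fun W a b hab => ?_
  rw [← Category.assoc, hd a b, zero_comp]
  rwa [← cancel_mono f, Category.assoc, Category.assoc]

theorem mono_comp_cokernel_π_of_disjoint {Q X : A} (j : Q ⟶ X) [Mono j] {K : Subobject X}
    (hK : Disjoint K (Subobject.mk j)) : Mono (j ≫ cokernel.π K.arrow) :=
  Preadditive.mono_of_cancel_zero _ fun f hf => by
    rw [← Category.assoc, ← Subobject.factors_iff_comp_cokernel] at hf
    rw [← cancel_mono j, zero_comp]
    exact Subobject.disjoint_iff_forall_factors.1 hK _ hf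
      ((Subobject.mk_factors_iff_exists).2 ⟨f, rfl⟩)

/-- If the image of `d` met `Q` only in zero, the preimage in `X` of this image would still be
disjoint from `Q`. By maximality it lies in `K`, so `d` vanishes. -/
theorem isEssentialHom_comp_cokernel_π {Q X : A} (j : Q ⟶ X) [Mono j] {K : Subobject X}
    (hK : Maximal (fun K => Disjoint K (Subobject.mk j)) K) :
    IsEssentialHom (j ≫ cokernel.π K.arrow) := fun Z d hd => by
  let p := cokernel.π K.arrow
  let K' := kernelSubobject (p ≫ cokernel.π d)
  have hle : K ≤ K' := le_kernelSubobject _ _ (by simp [p])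
  have hdis : Disjoint K' (Subobject.mk j) := by
    rw [Subobject.disjoint_iff_forall_factors]
    intro T t ht hj
    obtain ⟨b, hb⟩ := (Subobject.mk_factors_iff_exists).1 hj
    rw [kernelSubobject_factors_iff, ← Category.assoc] at ht
    obtain ⟨T', e, _, x, hx⟩ :=
      (Limits.CokernelCofork.IsColimit.comp_π_eq_zero_iff_up_to_refinements
      (cokernelIsCokernel d) (t ≫ p)).1 ht
    have h0 : x ≫ d = 0 := hd x (e ≫ b) (by
      rw [← hx, ← hb, Category.assoc, Category.assoc])
    refine Subobject.disjoint_iff_forall_factors.1 hK.prop _ ?_ hj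
    rw [Subobject.factors_iff_comp_cokernel]
    change t ≫ p = 0
    rw [← cancel_epi e, hx, h0, comp_zero]
  have hK' : K' ≤ K := hK.le_of_ge hdis hle
  obtain ⟨W, e, _, x, hx⟩ := surjective_up_to_refinements_of_epi p d
  have hx' : K'.Factors x := by
    rw [kernelSubobject_factors_iff, ← Category.assoc, ← hx, Category.assoc, cokernel.condition,
      comp_zero]
  have := (Subobject.factors_iff_comp_cokernel _ _).1 (Subobject.factors_of_le _ hK' hx')
  rw [← cancel_epi e, hx, comp_zero]
  exact this

variable [IsLocallyNoetherian A]

/-- Zorn's lemma applies because a Noetherian test object mapping to the union of a chain already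
maps to a member, which is disjoint from `P`. -/
theorem exists_maximal_disjoint {X : A} (P K₀ : Subobject X) (h : Disjoint K₀ P) :
    ∃ K, K₀ ≤ K ∧ Maximal (fun K => Disjoint K P) K := by
  refine zorn_le_nonempty₀ {K | Disjoint K P} (fun c hc hchain y hy => ?_) K₀ h
  refine ⟨sSup c, ?_, fun z hz => le_sSup hz⟩
  refine Subobject.disjoint_iff_forall_factors.2 fun Z f hf hP => ?_
  refine eq_zero_of_noetherian_comp_eq_zero _ fun N _ g => ?_
  obtain ⟨Q, hQ, hgQ⟩ := exists_factors_of_factors_sSup (g ≫ f) ⟨y, hy⟩ hchain.directedOn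
    (Subobject.factors_of_factors_right g hf)
  exact Subobject.disjoint_iff_forall_factors.1 (hc hQ) _ hgQ
    (Subobject.factors_of_factors_right g hP)

/-- An object is injective if morphisms to it extend along monomorphisms between Noetherian
objects. -/
theorem injective_of_noetherian_extension (J : A)
    (h : ∀ (N G : A) [IsNoetherianObject N] [IsNoetherianObject G] (i : N ⟶ G) [Mono i]
      (f : N ⟶ J), ∃ g, i ≫ g = f) : Injective J := by
  let j := Injective.ι J
  obtain ⟨K, -, hK⟩ := exists_maximal_disjoint (Subobject.mk j) ⊥ disjoint_bot_left
  let e := j ≫ cokernel.π K.arrow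
  have hmono : Mono e := mono_comp_cokernel_π_of_disjoint j hK.prop
  have hess : IsEssentialHom e := isEssentialHom_comp_cokernel_π j hK
  -- The map `e` is an essential embedding of `J` in a quotient of an injective. Given `g` from a
  -- Noetherian `N`, the part of `N` landing in `J` is Noetherian, so its map to `J` extends to `k`
  -- on `N`. Then `g - k ≫ e` meets `J` only in zero and vanishes by essentiality. Hence `e` is an
  -- isomorphism and `J` is a retract of an injective.
  have hepi : Epi e := by
    refine Abelian.epi_of_cokernel_π_eq_zero _ (eq_zero_of_noetherian_comp_eq_zero _
      fun N _ g => ?_)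
    have : IsNoetherianObject (pullback e g) := isNoetherianObject_of_mono (pullback.snd e g)
    obtain ⟨k, hk⟩ := h _ _ (pullback.snd e g) (pullback.fst e g)
    have hd : g - k ≫ e = 0 := hess _ fun W a b hab => by
      have h1 : (b + a ≫ k) ≫ e = a ≫ g := by
        rw [Preadditive.add_comp, ← hab, Preadditive.comp_sub, Category.assoc, sub_add_cancel]
      have h2 : a = pullback.lift _ _ h1 ≫ pullback.snd e g := (pullback.lift_snd _ _ _).symm
      rw [Preadditive.comp_sub, h2, Category.assoc, Category.assoc, ← pullback.condition,
        ← Category.assoc (pullback.snd e g), hk, sub_self]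
    rw [sub_eq_zero.1 hd, Category.assoc, cokernel.condition, comp_zero]
  have : IsIso e := isIso_of_mono_of_epi e
  exact Retract.injective (Y := Injective.under J)
    { i := j, r := cokernel.π K.arrow ≫ inv e, retract := by
        rw [← Category.assoc]; exact IsIso.hom_inv_id e }

open Classical in
/-- Coproducts of injective objects are injective. -/
theorem injective_sigma {X : Type v} (c : X → A) [∀ x, Injective (c x)] : Injective (∐ c) := by
  refine injective_of_noetherian_extension _ fun N G _ _ i _ f => ?_
  obtain ⟨F, hF⟩ := exists_finset_sum_comp_π_ι c f
  refine ⟨∑ x ∈ F, Injective.factorThru (f ≫ Sigma.π c x) i ≫ Sigma.ι c x, ?_⟩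
  rw [Preadditive.comp_sum]
  refine Eq.trans (Finset.sum_congr rfl fun x _ => ?_) hF.symm
  rw [← Category.assoc, Injective.comp_factorThru]

/-- A subobject of an injective object has an essential extension which is a direct summand. -/
theorem exists_essential_retract {Q J : A} (q : Q ⟶ J) [Mono q] [Injective J] :
    ∃ (L : A) (a : Q ⟶ L) (r : Retract L J), a ≫ r.i = q ∧ IsEssentialHom a := by
  -- `K` is a maximal complement of `Q`, and `L` is a maximal complement of `K` containing `Q`. The
  -- claim is that `L` is a summand complementary to `K`.
  obtain ⟨K, -, hK⟩ := exists_maximal_disjoint (Subobject.mk q) ⊥ disjoint_bot_left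
  obtain ⟨L, hQL, hL⟩ := exists_maximal_disjoint K (Subobject.mk q) hK.prop.symm
  let p := cokernel.π K.arrow
  have hess : IsEssentialHom (q ≫ p) := isEssentialHom_comp_cokernel_π q hK
  let a : Q ⟶ (L : A) := L.factorThru q
    (Subobject.factors_of_le q hQL (Subobject.mk_factors_self q))
  have ha : a ≫ L.arrow = q := L.factorThru_arrow _ _
  have hLp : Mono (L.arrow ≫ p) := by
    refine mono_comp_cokernel_π_of_disjoint L.arrow ?_
    rw [Subobject.mk_arrow]
    exact hL.prop.symm
  -- The inclusion of `L` extends to `φ : J / K ⟶ J`, which is mono because it is mono on the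
  -- essential subobject `Q`. Its image contains `L` and is still disjoint from `K`, so it equals
  -- `L`, and `φ` provides the retraction.
  let φ := Injective.factorThru L.arrow (L.arrow ≫ p)
  have hφ : (L.arrow ≫ p) ≫ φ = L.arrow := Injective.comp_factorThru _ _
  have hφm : Mono φ := by
    have : Mono ((q ≫ p) ≫ φ) := by
      rw [← ha, Category.assoc, Category.assoc, ← Category.assoc L.arrow, hφ, ha]
      infer_instance
    exact hess.mono_of_mono_comp φ
  have hLφ : L ≤ Subobject.mk φ :=
    Subobject.le_of_factors ((Subobject.mk_factors_iff_exists).2 ⟨L.arrow ≫ p, hφ⟩)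
  have hdis : Disjoint (Subobject.mk φ) K := by
    rw [Subobject.disjoint_iff_forall_factors]
    intro T t ht htK
    obtain ⟨b, hb⟩ := (Subobject.mk_factors_iff_exists).1 ht
    have hb0 : b = 0 := hess _ fun W x y hxy => by
      have h1 : x ≫ t = y ≫ q := by
        have := congrArg (· ≫ φ) hxy
        simp only [Category.assoc] at this
        rw [hb, ← ha, Category.assoc, ← Category.assoc L.arrow, hφ, ha] at this
        exact this
      have h2 : x ≫ t = 0 := Subobject.disjoint_iff_forall_factors.1 hK.prop _
        (Subobject.factors_of_factors_right x htK)
        ((Subobject.mk_factors_iff_exists).2 ⟨y, h1.symm⟩)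
      rw [hxy, ← Category.assoc, ← h1, h2, zero_comp]
    rw [← hb, hb0, zero_comp]
  have hφL : L.Factors φ := Subobject.factors_of_le _ (hL.le_of_ge hdis hLφ)
    (Subobject.mk_factors_self φ)
  refine ⟨L, a, { i := L.arrow, r := p ≫ L.factorThru φ hφL, retract := ?_ }, ha, ?_⟩
  · rw [← cancel_mono L.arrow, Category.assoc, Category.assoc, Subobject.factorThru_arrow,
      ← Category.assoc, hφ, Category.id_comp]
  · refine IsEssentialHom.of_comp_mono (f := L.arrow ≫ p) ?_
    rwa [← Category.assoc, ha]

end Essential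

/-! ### An injective object generating all injectives -/

section Generation

variable {A : Type u} [Category.{v} A] [Abelian A]

/-- A family of subobjects is independent if its sum is direct. -/
def IsIndependentFamily {T : Type*} {J : A} (o : T → Subobject J) (S : Set T) : Prop :=
  ∀ F : Finset T, (F : Set T) ⊆ S → ∀ ⦃N : A⦄ (f : ∀ t, N ⟶ (o t : A)),
    ∑ t ∈ F, f t ≫ (o t).arrow = 0 → ∀ t ∈ F, f t = 0

theorem exists_maximal_independentFamily {T : Type*} {J : A} (o : T → Subobject J)
    (P : Set T) : ∃ S, Maximal (fun S => S ⊆ P ∧ IsIndependentFamily o S) S := by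
  refine (zorn_subset_nonempty {S | S ⊆ P ∧ IsIndependentFamily o S}
    (fun c hc hchain hne => ⟨⋃₀ c, ⟨Set.sUnion_subset fun s hs => (hc hs).1, ?_⟩,
      fun s => Set.subset_sUnion_of_mem⟩) ∅ ⟨Set.empty_subset _, ?_⟩).imp fun S hS => hS.2
  · intro F hF
    obtain ⟨s, hs, hFs⟩ := hchain.directedOn.exists_mem_subset_of_finite_of_subset_sUnion hne
      F.finite_toSet hF
    exact (hc hs).2 F hFs
  · intro F hF N f _ t ht
    exact absurd (hF ht) (Set.notMem_empty _)

variable [IsLocallyNoetherian A]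

-- A morphism from a Noetherian object to the coproduct involves finitely many summands, so finite
-- independence suffices.
open Classical in
theorem IsIndependentFamily.mono_desc {T : Type v} {J : A} {o : T → Subobject J} {S : Set T}
    (hS : IsIndependentFamily o S) : Mono (Sigma.desc fun s : S => (o s).arrow) := by
  refine mono_of_noetherian _ fun N _ g hg => ?_
  obtain ⟨F, hF⟩ := exists_finset_sum_comp_π_ι _ g
  let f (t : T) : N ⟶ (o t : A) := if h : t ∈ S then g ≫ Sigma.π _ (⟨t, h⟩ : S) else 0
  have hf (s : S) : f s = g ≫ Sigma.π _ s := dif_pos s.2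
  have h0 : ∑ t ∈ F.map (Function.Embedding.subtype _), f t ≫ (o t).arrow = 0 := by
    rw [Finset.sum_map, ← hg, hF, Preadditive.sum_comp]
    refine Finset.sum_congr rfl fun s _ => ?_
    rw [Category.assoc, Sigma.ι_desc, ← hf]
    rfl
  rw [hF]
  refine Finset.sum_eq_zero fun s hs => ?_
  rw [← hf, hS _ (by simp) f h0 s (by simpa using hs), zero_comp]

/-- There is a small family of objects such that every nonzero object has a nonzero subobject
in this family. -/
theorem exists_family_mono_ne_zero (A : Type u) [Category.{v} A] [Abelian A]
    [IsLocallyNoetherian A] : ∃ (κ : Type v) (H : κ → A), ∀ Z : A, ¬ IsZero Z →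
      ∃ (k : κ) (q : H k ⟶ Z), Mono q ∧ q ≠ 0 := by
  obtain ⟨ι, G, -, hG⟩ := IsLocallyNoetherian.exists_noetherian_generators (A := A)
  -- The family consists of all quotients of the generators: the image of a nonzero morphism from `G
  -- i` is the quotient of `G i` by its kernel.
  refine ⟨Σ i, Shrink.{v} (Subobject (G i)),
    fun k => cokernel ((equivShrink _).symm k.2).arrow, fun Z hZ => ?_⟩
  obtain ⟨i, g, hg⟩ : ∃ i, ∃ g : G i ⟶ Z, g ≠ 0 := by
    by_contra! h
    refine hZ ((IsZero.iff_id_eq_zero Z).2 (hG _ _ fun _ hi g => ?_))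
    obtain ⟨i⟩ := hi
    rw [h i g, zero_comp, zero_comp]
  refine ⟨⟨i, equivShrink _ (kernelSubobject g)⟩, cokernel.desc _ g ?_, ?_, ?_⟩
  · rw [Equiv.symm_apply_apply, kernelSubobject_arrow_comp]
  · refine Preadditive.mono_of_cancel_zero _ fun {W} f hf => ?_
    obtain ⟨W', e, _, x, hx⟩ := surjective_up_to_refinements_of_epi (cokernel.π _) f
    rw [← cancel_epi e, hx, comp_zero, ← Subobject.factors_iff_comp_cokernel]
    dsimp only
    rw [Equiv.symm_apply_apply, kernelSubobject_factors_iff]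
    have := congrArg (e ≫ ·) hf
    dsimp only at this
    rwa [reassoc_of% hx, cokernel.π_desc, comp_zero] at this
  · intro h
    refine hg ?_
    rw [← cokernel.π_desc ((equivShrink _).symm (equivShrink _ (kernelSubobject g))).arrow g
      (by rw [Equiv.symm_apply_apply, kernelSubobject_arrow_comp]), h, comp_zero]

variable (A) in
/-- There is an injective object such that every injective object is a direct summand of a direct
sum of copies of it. -/
theorem exists_generatesInjectives : ∃ E : A, GeneratesInjectives E := by
  obtain ⟨κ, H, hH⟩ := exists_family_mono_ne_zero A
  let E := ∐ fun k => Injective.under (H k)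
  have hE : Injective E := injective_sigma _
  refine ⟨E, hE, fun J hJ => ?_⟩
  let o : Shrink.{v} (Subobject J) → Subobject J := (equivShrink _).symm
  let P : Set (Shrink.{v} (Subobject J)) := {t | Nonempty (Retract (o t : A) E)}
  obtain ⟨S, ⟨hSP, hS⟩, hmax⟩ := exists_maximal_independentFamily o P
  let ρ (s : S) : Retract (o s : A) E := (hSP s.2).some
  have hinj (s : S) : Injective (o s : A) := (ρ s).injective
  let D := ∐ fun s : S => (o s : A)
  have hD : Injective D := injective_sigma _
  let d : D ⟶ J := Sigma.desc fun s : S => (o s).arrow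
  have hd : Mono d := hS.mono_desc
  let r : J ⟶ D := Injective.factorThru (𝟙 D) d
  have hdr : d ≫ r = 𝟙 D := Injective.comp_factorThru _ _
  have hr (s : S) : (o s).arrow ≫ r = Sigma.ι (fun s : S => (o s : A)) s := by
    rw [← Category.comp_id (Sigma.ι _ s), ← hdr, ← Category.assoc, Sigma.ι_desc]
  -- The complement of `D` in `J` is `kernel r`, an injective object. If nonzero, it would contain
  -- some `H k` and a summand `L` essential over it.
  have hZ : IsZero (kernel r) := by
    by_contra hZ
    obtain ⟨k, q, _, hq0⟩ := hH _ hZ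
    have : Injective (kernel r) := Retract.injective (Y := J)
      { i := kernel.ι r
        r := kernel.lift r (𝟙 J - r ≫ d) (by
          rw [Preadditive.sub_comp, Category.assoc, hdr, Category.id_comp, Category.comp_id,
            sub_self])
        retract := by
          rw [← cancel_mono (kernel.ι r), Category.assoc, kernel.lift_ι, Preadditive.comp_sub,
            kernel.condition_assoc, zero_comp, sub_zero, Category.comp_id, Category.id_comp] }
    obtain ⟨L, a, ρL, ha, hess⟩ := exists_essential_retract q
    have hLinj : Injective L := ρL.injective
    have hamono : Mono a := by
      have : Mono (a ≫ ρL.i) := by rw [ha]; infer_instance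
      exact mono_of_mono a ρL.i
    -- By essentiality, the extension to `L` of the embedding of `H k` is mono. So the injective `L`
    -- is a summand of `Injective.under (H k)`, and thereby of `E`.
    let b : L ⟶ Injective.under (H k) := Injective.factorThru (Injective.ι _) a
    have hab : a ≫ b = Injective.ι _ := Injective.comp_factorThru _ _
    have hb : Mono b := by
      have : Mono (a ≫ b) := by rw [hab]; infer_instance
      exact hess.mono_of_mono_comp b
    let ℓ : L ⟶ J := ρL.i ≫ kernel.ι r
    have hℓr : ℓ ≫ r = 0 := by rw [Category.assoc, kernel.condition, comp_zero]
    have hi : Mono ρL.i := ⟨fun f g h => by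
      simpa [ρL.retract] using congrArg (· ≫ ρL.r) h⟩
    have hℓ : Mono ℓ := mono_comp _ _
    let t := equivShrink _ (Subobject.mk ℓ)
    have ht : o t = Subobject.mk ℓ := Equiv.symm_apply_apply _ _
    have htr : (o t).arrow ≫ r = 0 := by
      rw [ht, ← Subobject.underlyingIso_hom_comp_eq_mk, Category.assoc, hℓr, comp_zero]
    have hres : Retract L E :=
      { i := b ≫ Sigma.ι (fun k => Injective.under (H k)) k
        r := Injective.factorThru (𝟙 L) (b ≫ Sigma.ι (fun k => Injective.under (H k)) k)
        retract := Injective.comp_factorThru _ _ }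
    have htP : t ∈ P := by
      change Nonempty (Retract (o t : A) E)
      rw [ht]
      exact ⟨(Retract.ofIso (Subobject.underlyingIso ℓ)).trans hres⟩
    have hindep : IsIndependentFamily o (insert t S) := by
      classical
      intro F hF N f hf
      -- The projector `r ≫ d` onto `D` fixes the members of `S` and kills the new member `t`, so a
      -- relation splits into a relation within `S` and one for `t` alone.
      have key : ∑ x ∈ F.erase t, f x ≫ (o x).arrow = 0 := by
        have hFS : ∀ x ∈ F.erase t, x ∈ S := fun x hx =>
          (hF (Finset.mem_of_mem_erase hx)).resolve_left (Finset.ne_of_mem_erase hx)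
        have h1 : ∀ x ∈ F.erase t, (f x ≫ (o x).arrow) ≫ r ≫ d = f x ≫ (o x).arrow := by
          intro x hx
          rw [Category.assoc, reassoc_of% (hr ⟨x, hFS x hx⟩), Sigma.ι_desc]
        have h2 : (∑ x ∈ F.erase t, f x ≫ (o x).arrow) ≫ r ≫ d =
            (∑ x ∈ F, f x ≫ (o x).arrow) ≫ r ≫ d := by
          rw [Preadditive.sum_comp, Preadditive.sum_comp]
          refine Finset.sum_subset (Finset.erase_subset _ _) fun x hx hx' => ?_
          obtain rfl : x = t := by
            by_contra hne
            exact hx' (Finset.mem_erase.2 ⟨hne, hx⟩)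
          rw [Category.assoc, reassoc_of% htr, zero_comp, comp_zero]
        rw [hf, zero_comp, Preadditive.sum_comp, Finset.sum_congr rfl h1] at h2
        exact h2
      have h3 : ∀ x ∈ F.erase t, f x = 0 := hS _ (fun x hx =>
          (hF (Finset.mem_of_mem_erase hx)).resolve_left (Finset.ne_of_mem_erase hx)) f key
      intro x hx
      by_cases hxt : x = t
      · subst hxt
        rw [← Finset.add_sum_erase _ _ hx, key, add_zero] at hf
        rwa [← cancel_mono (o _).arrow, zero_comp]
      · exact h3 x (Finset.mem_erase.2 ⟨hxt, hx⟩)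
    have htS : t ∈ S := hmax ⟨Set.insert_subset htP hSP, hindep⟩ (Set.subset_insert _ _)
      (Set.mem_insert _ _)
    -- Maximality puts `t` in `S`, so `r` followed by `d` is the identity on it; but `r` kills it.
    have hι : (o t).arrow = 0 := by
      have h4 := hr ⟨t, htS⟩
      have h5 : Sigma.ι (fun s : S => (o s : A)) ⟨t, htS⟩ ≫ d = (o t).arrow := Sigma.ι_desc _ _
      rw [← h5, ← h4, htr, zero_comp]
    have hℓ0 : ℓ = 0 := by
      rw [ht] at hι
      rw [← Subobject.underlyingIso_arrow ℓ, hι, comp_zero]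
    refine hq0 ?_
    rw [← ha, ← cancel_mono (kernel.ι r), Category.assoc]
    change a ≫ ℓ = _
    rw [hℓ0, comp_zero, zero_comp]
  have hrd : r ≫ d = 𝟙 J := by
    have h : kernel.lift r (𝟙 J - r ≫ d) (by
      rw [Preadditive.sub_comp, Category.assoc, hdr, Category.id_comp, Category.comp_id,
        sub_self]) ≫ kernel.ι r = _ := kernel.lift_ι _ _ _
    rw [hZ.eq_zero_of_src (kernel.ι r), comp_zero] at h
    exact (sub_eq_zero.1 h.symm).symm
  refine ⟨S, Cofan.mk (∐ fun _ : S => E) (Sigma.ι _), ⟨coproductIsCoproduct _⟩, ⟨?_⟩⟩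
  exact
    { i := r ≫ Limits.Sigma.map fun s => (ρ s).i
      r := (Limits.Sigma.map fun s => (ρ s).r) ≫ d
      retract := by
        have h : (Limits.Sigma.map fun s => (ρ s).i) ≫
            (Limits.Sigma.map fun s => (ρ s).r) = 𝟙 D := by
          refine Sigma.hom_ext _ _ fun s => ?_
          rw [Sigma.ι_map_assoc, Sigma.ι_map, reassoc_of% (ρ s).retract, Category.comp_id]
        rw [Category.assoc, reassoc_of% h, Category.id_comp, hrd] }

end Generation

/-! ### Gluing morphisms along Noetherian subobjects -/

section Gluing

variable {A : Type u} [Category.{v} A] [Abelian A]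

theorem exists_isNoetherianObject_ge_of_finset {X : A} {T : Type*} (m : T → Subobject X)
    (hm : ∀ t, IsNoetherianObject (m t : A)) (F : Finset T) :
    ∃ R : Subobject X, IsNoetherianObject (R : A) ∧ ∀ t ∈ F, m t ≤ R := by
  classical
  induction F using Finset.induction_on with
  | empty =>
    exact ⟨⊥, isNoetherianObject_of_isZero ((isZero_zero A).of_iso Subobject.botCoeIsoZero),
      fun t ht => absurd ht (Finset.notMem_empty t)⟩
  | insert t F _ ih =>
    obtain ⟨R, hR, hF⟩ := ih
    have := hm t
    obtain ⟨R', hR', h₁, h₂⟩ := exists_isNoetherianObject_ge (m t) R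
    refine ⟨R', hR', fun s hs => ?_⟩
    obtain rfl | hs := Finset.mem_insert.1 hs
    · exact h₁
    · exact (hF s hs).trans h₂

variable [IsLocallyNoetherian A]

theorem hom_ext_of_noetherianSubobject {X Y : A} {f f' : X ⟶ Y}
    (h : ∀ M : Subobject X, IsNoetherianObject (M : A) → M.arrow ≫ f = M.arrow ≫ f') : f = f' :=
  hom_ext_of_noetherian fun N _ g => by
    rw [← imageSubobject_arrow_comp g, Category.assoc, Category.assoc,
      h _ (isNoetherianObject_imageSubobject g)]

/-- A compatible family of morphisms on the Noetherian subobjects of an object extends to the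
whole object. -/
theorem exists_glue {E J : A} (g : ∀ M : Subobject E, (M : A) ⟶ J)
    (hg : ∀ (M M' : Subobject E), IsNoetherianObject (M : A) → IsNoetherianObject (M' : A) →
      ∀ h : M ≤ M', Subobject.ofLE M M' h ≫ g M' = g M) :
    ∃ φ : E ⟶ J, ∀ M : Subobject E, IsNoetherianObject (M : A) → M.arrow ≫ φ = g M := by
  classical
  obtain ⟨ι, G, hG, hsep⟩ := IsLocallyNoetherian.exists_noetherian_generators (A := A)
  let m (t : Σ i, G i ⟶ E) : Subobject E := imageSubobject t.2
  have hm (t : Σ i, G i ⟶ E) : IsNoetherianObject (m t : A) :=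
    have := hG t.1
    isNoetherianObject_imageSubobject t.2
  let c (t : Σ i, G i ⟶ E) : A := G t.1
  let fac (t : Σ i, G i ⟶ E) : c t ⟶ (m t : A) := factorThruImageSubobject t.2
  have hfac (t : Σ i, G i ⟶ E) : fac t ≫ (m t).arrow = t.2 := imageSubobject_arrow_comp t.2
  -- The coproduct over all morphisms from generators covers `E`. The given family defines a
  -- morphism `h` on it, which has to be shown to vanish on the kernel of `p`.
  let p : ∐ c ⟶ E := Limits.Sigma.desc fun t => t.2
  let h : ∐ c ⟶ J := Limits.Sigma.desc fun t => fac t ≫ g (m t)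
  have hιp (t : Σ i, G i ⟶ E) : Sigma.ι c t ≫ p = t.2 := Sigma.ι_desc _ _
  have hp : Epi p := Preadditive.epi_of_cancel_zero _ fun q hq => hsep _ _ fun _ hi k => by
    obtain ⟨i⟩ := hi
    have : k = Sigma.ι c ⟨i, k⟩ ≫ p := (hιp ⟨i, k⟩).symm
    rw [this, Category.assoc, hq, comp_zero, comp_zero]
  have hker : kernel.ι p ≫ h = 0 := by
    -- A Noetherian part of the kernel involves finitely many summands, whose images lie in a common
    -- Noetherian subobject `R`. There `h` factors through `g R`, and the morphism to `R` is zero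
    -- because `R` embeds in `E`.
    refine eq_zero_of_noetherian_comp_eq_zero _ fun N _ k => ?_
    obtain ⟨F, hF⟩ := exists_finset_sum_comp_π_ι c (k ≫ kernel.ι p)
    obtain ⟨R, hR, hFR⟩ := exists_isNoetherianObject_ge_of_finset m hm F
    let w (t : Σ i, G i ⟶ E) : c t ⟶ (R : A) :=
      if ht : m t ≤ R then fac t ≫ Subobject.ofLE _ _ ht else 0
    have hw₁ : ∀ t ∈ F, fac t ≫ g (m t) = w t ≫ g R := fun t ht => by
      simp only [w]
      rw [dif_pos (hFR t ht), Category.assoc, hg _ _ (hm t) hR]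
    have hw₂ : ∀ t ∈ F, t.2 = w t ≫ R.arrow := fun t ht => by
      simp only [w]
      rw [dif_pos (hFR t ht), Category.assoc, Subobject.ofLE_arrow, hfac]
    let f : N ⟶ (R : A) := ∑ t ∈ F, ((k ≫ kernel.ι p) ≫ Sigma.π c t) ≫ w t
    have hfR : f ≫ R.arrow = (k ≫ kernel.ι p) ≫ p := by
      conv_rhs => rw [hF]
      rw [Preadditive.sum_comp, Preadditive.sum_comp]
      refine Finset.sum_congr rfl fun t ht => ?_
      rw [Category.assoc, Category.assoc _ (Sigma.ι c t), Sigma.ι_desc, ← hw₂ t ht]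
    have hf0 : f = 0 := by
      rw [← cancel_mono R.arrow, hfR, Category.assoc, kernel.condition, comp_zero, zero_comp]
    rw [← Category.assoc, hF, Preadditive.sum_comp]
    have hfg : f ≫ g R = 0 := by rw [hf0, zero_comp]
    rw [Preadditive.sum_comp] at hfg
    rw [← hfg]
    refine Finset.sum_congr rfl fun t ht => ?_
    rw [Category.assoc _ (Sigma.ι c t), Sigma.ι_desc, hw₁ t ht, ← Category.assoc]
  refine ⟨Abelian.epiDesc p h hker, fun M hM => ?_⟩
  refine hsep _ _ fun _ hi x => ?_
  obtain ⟨i⟩ := hi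
  let t : Σ i, G i ⟶ E := ⟨i, x ≫ M.arrow⟩
  have hle : m t ≤ M := imageSubobject_le _ x rfl
  have h1 : x ≫ M.arrow = Sigma.ι c t ≫ p := (hιp t).symm
  have h2 : x = fac t ≫ Subobject.ofLE _ _ hle := by
    rw [← cancel_mono M.arrow, Category.assoc, Subobject.ofLE_arrow, hfac]
  rw [← Category.assoc, h1, Category.assoc, Abelian.comp_epiDesc, Sigma.ι_desc,
    ← hg _ _ (hm t) hM hle, ← Category.assoc, ← h2]

end Gluing

/-! ### The complete topological ring `EndOp E` -/

section EndOpTopology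

namespace EndOp

section

variable {A : Type u} [Category.{v} A] {E : A}

/-- The element of `EndOp E` given by an endomorphism of `E`. -/
def of (f : E ⟶ E) : EndOp E := MulOpposite.op f

theorem hom_injective : Function.Injective (EndOp.hom : EndOp E → (E ⟶ E)) :=
  MulOpposite.unop_injective

end

variable {A : Type u} [Category.{v} A] [Abelian A] {E : A}

@[simp] theorem hom_zero : (0 : EndOp E).hom = 0 := rfl

@[simp] theorem hom_one : (1 : EndOp E).hom = 𝟙 E := rfl

@[simp] theorem hom_add (r s : EndOp E) : (r + s).hom = r.hom + s.hom := rfl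

@[simp] theorem hom_neg (r : EndOp E) : (-r).hom = -r.hom := rfl

@[simp] theorem hom_mul (r s : EndOp E) : (r * s).hom = r.hom ≫ s.hom := rfl

/-- The additive group isomorphism between `EndOp E` and the endomorphisms of `E`. -/
def homEquiv : EndOp E ≃+ (E ⟶ E) where
  toFun := hom
  invFun := of
  left_inv _ := rfl
  right_inv _ := rfl
  map_add' _ _ := rfl

/-- The annihilator of a subobject, as a right ideal of `EndOp E`. -/
def annihilator (M : Subobject E) : Submodule (EndOp E)ᵐᵒᵖ (EndOp E) where
  carrier := {r | M.arrow ≫ r.hom = 0}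
  add_mem' {r s} hr hs := by
    change _ = _ at hr hs
    change _ = _
    rw [hom_add, Preadditive.comp_add, hr, hs, add_zero]
  zero_mem' := comp_zero
  smul_mem' c r hr := by
    change _ = _ at hr
    change M.arrow ≫ r.hom ≫ c.unop.hom = 0
    rw [← Category.assoc, hr, zero_comp]

theorem hasBasis_uniformity : (uniformity (EndOp E)).HasBasis
    (fun M : Subobject E => IsNoetherianObject (M : A))
    fun M => {p | M.arrow ≫ p.1.hom = M.arrow ≫ p.2.hom} := by
  let I := {M : Subobject E // IsNoetherianObject (M : A)}
  have h : uniformity (EndOp E) =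
      ⨅ M : I, 𝓟 {p : EndOp E × EndOp E | M.1.arrow ≫ p.1.hom = M.1.arrow ≫ p.2.hom} := by
    refine iInf_uniformity.trans (iInf_congr fun M => ?_)
    rw [uniformity_comap, bot_uniformity, comap_principal]
    rfl
  have : Nonempty I := ⟨⟨⊥, isNoetherianObject_of_isZero
    ((isZero_zero A).of_iso Subobject.botCoeIsoZero)⟩⟩
  have hd : Directed (· ≥ ·) fun M : I =>
      {p : EndOp E × EndOp E | M.1.arrow ≫ p.1.hom = M.1.arrow ≫ p.2.hom} := by
    rintro ⟨M, hM⟩ ⟨M', hM'⟩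
    obtain ⟨R, hR, h₁, h₂⟩ := exists_isNoetherianObject_ge M M'
    have key : ∀ {P : Subobject E}, P ≤ R →
        {p : EndOp E × EndOp E | R.arrow ≫ p.1.hom = R.arrow ≫ p.2.hom} ⊆
          {p | P.arrow ≫ p.1.hom = P.arrow ≫ p.2.hom} := fun {P} hP p hp => by
      change _ = _ at hp
      change _ = _
      rw [← Subobject.ofLE_arrow hP, Category.assoc, Category.assoc, hp]
    exact ⟨⟨R, hR⟩, key h₁, key h₂⟩
  rw [h]
  refine (hasBasis_iInf_principal hd).to_hasBasis (fun M _ => ⟨M.1, M.2, subset_rfl⟩)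
    fun M hM => ⟨⟨M, hM⟩, trivial, subset_rfl⟩

theorem hasBasis_nhds (r : EndOp E) : (𝓝 r).HasBasis
    (fun M : Subobject E => IsNoetherianObject (M : A))
    fun M => {s | M.arrow ≫ s.hom = M.arrow ≫ r.hom} := by
  refine (nhds_basis_uniformity' hasBasis_uniformity).to_hasBasis (fun M hM => ⟨M, hM, ?_⟩)
    fun M hM => ⟨M, hM, ?_⟩
  · exact fun s hs => Eq.symm hs
  · exact fun s hs => Eq.symm hs

theorem hasBasis_nhds_zero : (𝓝 (0 : EndOp E)).HasBasis
    (fun M : Subobject E => IsNoetherianObject (M : A)) fun M => {r | M.arrow ≫ r.hom = 0} := by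
  simpa using hasBasis_nhds (0 : EndOp E)

instance : IsUniformAddGroup (EndOp E) where
  uniformContinuous_sub := by
    rw [UniformContinuous, (hasBasis_uniformity.tendsto_right_iff)]
    intro M hM
    rw [uniformity_prod_eq_comap_prod, eventually_comap]
    refine mem_of_superset (prod_mem_prod (hasBasis_uniformity.mem_of_mem hM)
      (hasBasis_uniformity.mem_of_mem hM)) ?_
    rintro ⟨⟨a, b⟩, ⟨c, d⟩⟩ ⟨h₁, h₂⟩ ⟨⟨a', c'⟩, ⟨b', d'⟩⟩ h
    simp only [Prod.mk.injEq] at h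
    obtain ⟨⟨rfl, rfl⟩, rfl, rfl⟩ := h
    change M.arrow ≫ (a' - c').hom = M.arrow ≫ (b' - d').hom
    change M.arrow ≫ a'.hom = M.arrow ≫ b'.hom at h₁
    change M.arrow ≫ c'.hom = M.arrow ≫ d'.hom at h₂
    rw [sub_eq_add_neg, sub_eq_add_neg]
    simp only [hom_add, hom_neg, Preadditive.comp_add, Preadditive.comp_neg, h₁, h₂]

instance : IsTopologicalRing (EndOp E) where
  continuous_mul := by
    rw [continuous_iff_continuousAt]
    rintro ⟨r, s⟩
    refine (hasBasis_nhds (r * s)).tendsto_right_iff.2 fun M hM => ?_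
    -- On `M`, the product depends only on `r` restricted to `M` and on `s` restricted to the image
    -- of `M` under `r`, which is Noetherian.
    have hM' := isNoetherianObject_imageSubobject (M.arrow ≫ r.hom)
    rw [nhds_prod_eq]
    refine mem_of_superset (prod_mem_prod ((hasBasis_nhds r).mem_of_mem hM)
      ((hasBasis_nhds s).mem_of_mem hM')) ?_
    rintro ⟨r', s'⟩ ⟨h₁, h₂⟩
    change _ = _ at h₁ h₂
    change M.arrow ≫ (r' * s').hom = _
    simp only [hom_mul]
    rw [← Category.assoc, h₁, ← Category.assoc, ← imageSubobject_arrow_comp (M.arrow ≫ r.hom),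
      Category.assoc, Category.assoc, h₂]

instance : IsLinearTopology (EndOp E)ᵐᵒᵖ (EndOp E) :=
  IsLinearTopology.mk_of_hasBasis _ (s := annihilator) hasBasis_nhds_zero

variable [IsLocallyNoetherian A]

instance : T2Space (EndOp E) := by
  have : T0Space (EndOp E) := t0Space_iff_uniformity.2 fun r s h => hom_injective <|
    hom_ext_of_noetherianSubobject fun M hM => h _ (hasBasis_uniformity.mem_of_mem hM)
  infer_instance

instance : CompleteSpace (EndOp E) where
  complete {f} hf := by
    obtain ⟨hne, hf⟩ := hf
    -- A Cauchy filter is eventually constant on each Noetherian subobject; the limit is glued from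
    -- these values. The value `0` at other subobjects is never used.
    have key : ∀ M : Subobject E, ∃ g : (M : A) ⟶ E,
        IsNoetherianObject (M : A) → ∀ᶠ r in f, M.arrow ≫ EndOp.hom r = g := fun M => by
      by_cases hM : IsNoetherianObject (M : A)
      · have h := hf (hasBasis_uniformity.mem_of_mem hM)
        obtain ⟨t, ht, hsub⟩ := mem_prod_same_iff.1 h
        obtain ⟨r, hr⟩ := hne.nonempty_of_mem ht
        exact ⟨M.arrow ≫ EndOp.hom r, fun _ => mem_of_superset ht fun s hs =>
          hsub (Set.mk_mem_prod hs hr)⟩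
      · exact ⟨0, fun h => absurd h hM⟩
    choose g hg using key
    obtain ⟨φ, hφ⟩ := exists_glue g fun M M' hM hM' h => by
      obtain ⟨r, h₁, h₂⟩ := ((hg M hM).and (hg M' hM')).exists
      rw [← h₁, ← h₂, ← Category.assoc, Subobject.ofLE_arrow]
    refine ⟨of φ, (hasBasis_nhds (of φ)).ge_iff.2 fun M hM => ?_⟩
    filter_upwards [hg M hM] with r hr
    change _ = M.arrow ≫ φ
    rw [hr, hφ M hM]

instance : IsContraRing (EndOp E) where

end EndOp

end EndOpTopology

/-! ### The additive structure of `R[[X]]` -/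

namespace ConvComb

variable {R : Type*} [Ring R] [UniformSpace R] [IsContraRing R] {X Y Z : Type*}

instance : Add (ConvComb R X) := ⟨fun f g => ⟨fun x => f.1 x + g.1 x, by simpa using f.2.add g.2⟩⟩

instance {R : Type*} [Ring R] [UniformSpace R] : Zero (ConvComb R X) :=
  ⟨⟨fun _ => 0, tendsto_const_nhds⟩⟩

instance : Neg (ConvComb R X) := ⟨fun f => ⟨fun x => -f.1 x, by simpa using f.2.neg⟩⟩

theorem zero_apply {R : Type*} [Ring R] [UniformSpace R] (x : X) : (0 : ConvComb R X).1 x = 0 := rfl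

theorem add_apply (f g : ConvComb R X) (x : X) : (f + g).1 x = f.1 x + g.1 x := rfl

theorem neg_apply (f : ConvComb R X) (x : X) : (-f).1 x = -f.1 x := rfl

theorem map_single (g : X → Y) (x : X) : map g (single x : ConvComb R X) = single (g x) :=
  single_bind _ _

theorem map_map (g : X → Y) (h : Y → Z) (f : ConvComb R X) :
    map h (map g f) = map (fun x => h (g x)) f :=
  bind_map _ _ _

theorem map_id (f : ConvComb R X) : map (fun x => x) f = f := bind_single f

theorem add_bind (f g : ConvComb R X) (k : X → ConvComb R Y) :
    bind (f + g) k = bind f k + bind g k := by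
  ext y
  simp only [bind_apply, add_apply, add_mul]
  exact (summable_fst f.2 (fun x => (k x).2) y).tsum_add (summable_fst g.2 (fun x => (k x).2) y)

theorem zero_bind (k : X → ConvComb R Y) : bind (0 : ConvComb R X) k = 0 := by
  ext y
  simp [bind_apply, zero_apply]

theorem neg_bind (f : ConvComb R X) (k : X → ConvComb R Y) : bind (-f) k = -bind f k := by
  ext y
  simp [bind_apply, neg_apply, tsum_neg]

theorem bind_add (f : ConvComb R X) (k l : X → ConvComb R Y) :
    bind f (fun x => k x + l x) = bind f k + bind f l := by
  ext y
  simp only [bind_apply, add_apply, mul_add]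
  exact (summable_fst f.2 (fun x => (k x).2) y).tsum_add (summable_fst f.2 (fun x => (l x).2) y)

end ConvComb

/-! ### The abelian category of contramodules -/

namespace Contramodule

variable {R : Type v} [Ring R] [UniformSpace R] [IsContraRing R]

open ConvComb

section Action

variable (C D : Contramodule R) {X Y : Type*}

/-- The infinite linear combination `∑ r_x k(x)` in a contramodule. -/
noncomputable def act (f : ConvComb R X) (k : X → C.A) : C.A := C.a (map k f : ConvComb R C.A)

variable {C D}

theorem act_single (x : X) (k : X → C.A) : act C (single x) k = k x := by
  rw [act, map_single]
  exact ConcreteCategory.congr_hom C.unit (k x)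

theorem act_act (f : ConvComb R X) (g : X → ConvComb R Y) (k : Y → C.A) :
    act C f (fun x => act C (g x) k) = act C (bind f g) k := by
  have h := ConcreteCategory.congr_hom C.assoc
    (map (fun x => map k (g x)) f : ConvComb R (ConvComb R C.A))
  refine Eq.trans ?_ (h.symm.trans ?_)
  · exact congrArg C.a (ConvComb.map_map _ _ _).symm
  · refine congrArg C.a ?_
    exact (ConvComb.bind_map _ _ _).trans (ConvComb.map_bind f g k).symm

theorem act_map (h : X → Y) (f : ConvComb R X) (k : Y → C.A) :
    act C (map h f) k = act C f fun x => k (h x) := by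
  exact congrArg C.a (ConvComb.map_map _ _ _)

theorem hom_act (φ : C ⟶ D) (f : ConvComb R X) (k : X → C.A) :
    φ.f (act C f k) = act D f fun x => φ.f (k x) := by
  have h := ConcreteCategory.congr_hom φ.h (map k f : ConvComb R C.A)
  refine Eq.trans h.symm ?_
  exact congrArg D.a (ConvComb.map_map _ _ _)

/-- A map preserving infinite linear combinations is a morphism of contramodules. -/
def homMk (φ : C.A → D.A) (h : ∀ f : ConvComb R C.A, φ (act C f fun x => x) = act D f φ) :
    C ⟶ D where
  f := ↾φ
  h := by
    refine TypeCat.homEquiv.injective (funext fun f => ?_)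
    refine (h f).symm.trans (congrArg φ ?_)
    exact congrArg C.a (map_id _)

theorem hom_ext {φ ψ : C ⟶ D} (h : ∀ x, φ.f x = ψ.f x) : φ = ψ :=
  Monad.Algebra.Hom.ext (TypeCat.homEquiv.injective (funext h))

/-- A contramodule is determined by a set with infinite linear combinations satisfying the unit
and associativity laws. -/
noncomputable def mk (Q : Type v) (a : ConvComb R Q → Q) (h₁ : ∀ q, a (single q) = q)
    (h₂ : ∀ F : ConvComb R (ConvComb R Q), a (bind F fun f => f) = a (map a F)) :
    Contramodule R where
  A := Q
  a := ↾a
  unit := TypeCat.homEquiv.injective (funext h₁)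
  assoc := TypeCat.homEquiv.injective (funext h₂)

theorem mk_act (Q : Type v) (a : ConvComb R Q → Q) (h₁ h₂) (f : ConvComb R X) (k : X → Q) :
    act (mk Q a h₁ h₂) f k = a (map k f) := rfl

end Action

section AddCommGroup

variable {C D : Contramodule R} {X Y : Type*}

/-- The group operations are themselves contramodule operations: addition evaluates `1 · true + 1 ·
false`, zero the empty combination, and negation `-1` on one generator. Hence morphisms respect them
automatically. -/
noncomputable instance : Add C.A := ⟨fun x y => act C (single true + single false : ConvComb R Bool)
  fun b => bif b then x else y⟩

noncomputable instance : Zero C.A := ⟨act C (0 : ConvComb R Empty) Empty.elim⟩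

noncomputable instance : Neg C.A := ⟨fun x => act C (-single () : ConvComb R Unit) fun _ => x⟩

theorem act_add (f g : ConvComb R X) (k : X → C.A) : act C (f + g) k = act C f k + act C g k := by
  have h : f + g = bind (single true + single false : ConvComb R Bool)
      fun b => bif b then f else g := by
    rw [add_bind, single_bind, single_bind]; rfl
  rw [h, ← act_act]
  exact congrArg (act C _) (funext fun b => by cases b <;> rfl)

theorem act_zero (k : X → C.A) : act C (0 : ConvComb R X) k = 0 := by
  rw [← zero_bind (X := Empty) (Y := X) (R := R) Empty.elim, ← act_act]
  exact congrArg (act C _) (funext fun b => b.elim)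

theorem act_neg (f : ConvComb R X) (k : X → C.A) : act C (-f) k = -act C f k := by
  have h : -f = bind (-single () : ConvComb R Unit) fun _ => f := by
    rw [neg_bind, single_bind]
  rw [h, ← act_act]
  rfl

noncomputable instance : AddCommGroup C.A where
  add_assoc x y z := by
    calc x + y + z = act C (single x + single y + single z) fun x => x := by
          simp only [act_add, act_single]
      _ = act C (single x + (single y + single z)) fun x => x :=
          congrArg (act C · _) (ConvComb.ext fun _ => add_assoc _ _ _)
      _ = x + (y + z) := by simp only [act_add, act_single]
  zero_add x := by
    calc 0 + x = act C (0 + single x) fun x => x := by simp only [act_add, act_single, act_zero]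
      _ = act C (single x) fun x => x :=
          congrArg (act C · _) (ConvComb.ext fun _ => zero_add _)
      _ = x := act_single _ _
  add_zero x := by
    calc x + 0 = act C (single x + 0) fun x => x := by simp only [act_add, act_single, act_zero]
      _ = act C (single x) fun x => x :=
          congrArg (act C · _) (ConvComb.ext fun _ => add_zero _)
      _ = x := act_single _ _
  nsmul := nsmulRec
  zsmul := zsmulRec
  neg_add_cancel x := by
    calc -x + x = act C (-single x + single x) fun x => x := by
          simp only [act_add, act_single, act_neg]
      _ = act C (0 : ConvComb R C.A) fun x => x :=
          congrArg (act C · _) (ConvComb.ext fun _ => neg_add_cancel _)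
      _ = 0 := act_zero _
  add_comm x y := by
    calc x + y = act C (single x + single y) fun x => x := by simp only [act_add, act_single]
      _ = act C (single y + single x) fun x => x :=
          congrArg (act C · _) (ConvComb.ext fun _ => add_comm _ _)
      _ = y + x := by simp only [act_add, act_single]

theorem act_add_right (f : ConvComb R X) (k l : X → C.A) :
    act C f (fun x => k x + l x) = act C f k + act C f l := by
  -- Both families become values of one map on `X ⊕ X`, which reduces the claim to additivity of
  -- `bind` in its second argument.
  let m : X ⊕ X → C.A := Sum.elim k l
  have hk : act C f k = act C (bind f fun x => single (Sum.inl x : X ⊕ X)) m := by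
    rw [← act_act]; simp only [act_single]; rfl
  have hl : act C f l = act C (bind f fun x => single (Sum.inr x : X ⊕ X)) m := by
    rw [← act_act]; simp only [act_single]; rfl
  have hkl : act C f (fun x => k x + l x) =
      act C (bind f fun x => single (Sum.inl x : X ⊕ X) + single (Sum.inr x)) m := by
    rw [← act_act]; simp only [act_add, act_single]; rfl
  rw [hk, hl, hkl, bind_add, act_add]

theorem act_zero_right (f : ConvComb R X) : act C f (fun _ => 0) = 0 := by
  have h : ∀ f : ConvComb R X, act C f (fun _ => 0) = act C f (fun _ => 0) + act C f fun _ => 0 :=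
    fun f => by rw [← act_add_right]; simp only [add_zero]
  exact left_eq_add.1 (h f)

theorem act_neg_right (f : ConvComb R X) (k : X → C.A) :
    act C f (fun x => -k x) = -act C f k := by
  refine eq_neg_of_add_eq_zero_left ?_
  rw [← act_add_right]
  simp only [neg_add_cancel, act_zero_right]

theorem hom_add (φ : C ⟶ D) (x y : C.A) : φ.f (x + y) = φ.f x + φ.f y := by
  refine (hom_act φ _ _).trans ?_
  exact congrArg (act D _) (funext fun b => by cases b <;> rfl)

/-- The additive map underlying a morphism of contramodules. -/
noncomputable def addHom (φ : C ⟶ D) : C.A →+ D.A := AddMonoidHom.mk' φ.f (hom_add φ)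

theorem hom_zero (φ : C ⟶ D) : φ.f (0 : C.A) = (0 : D.A) := _root_.map_zero (addHom φ)

theorem hom_neg (φ : C ⟶ D) (x : C.A) : φ.f (-x) = -φ.f x := _root_.map_neg (addHom φ) x

theorem hom_sub (φ : C ⟶ D) (x y : C.A) : φ.f (x - y) = φ.f x - φ.f y :=
  _root_.map_sub (addHom φ) x y

noncomputable instance : Add (C ⟶ D) :=
  ⟨fun φ ψ => homMk (fun x => φ.f x + ψ.f x) fun f => by rw [hom_act, hom_act, act_add_right]⟩

noncomputable instance : Zero (C ⟶ D) := ⟨homMk (fun _ => 0) fun f => (act_zero_right f).symm⟩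

noncomputable instance : Neg (C ⟶ D) :=
  ⟨fun φ => homMk (fun x => -φ.f x) fun f => by rw [hom_act, act_neg_right]⟩

noncomputable instance : AddCommGroup (C ⟶ D) where
  add_assoc _ _ _ := hom_ext fun _ => add_assoc _ _ _
  zero_add _ := hom_ext fun _ => zero_add _
  add_zero _ := hom_ext fun _ => add_zero _
  nsmul := nsmulRec
  zsmul := zsmulRec
  neg_add_cancel _ := hom_ext fun _ => neg_add_cancel _
  add_comm _ _ := hom_ext fun _ => add_comm _ _

noncomputable instance (priority := 100) : Preadditive (Contramodule R) where
  add_comp _ _ _ φ ψ χ := hom_ext fun _ => hom_add χ _ _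
  comp_add _ _ _ _ _ _ := rfl

end AddCommGroup

section Free

variable {C D : Contramodule R} {X : Type v}

variable (R X) in
/-- The free contramodule `R[[X]]`. -/
noncomputable def free : Contramodule R :=
  mk (ConvComb R X) (fun F => bind F fun f => f) (fun f => single_bind f _) fun F => by
    rw [ConvComb.bind_assoc, ConvComb.bind_map]

theorem free_act {Y : Type*} (f : ConvComb R Y) (k : Y → ConvComb R X) :
    act (free R X) f k = (bind f k : ConvComb R X) :=
  ConvComb.bind_map _ _ _

/-- The generators of a free contramodule. -/
noncomputable def gen (x : X) : (free R X).A := (single x : ConvComb R X)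

theorem act_gen (f : ConvComb R X) : act (free R X) f gen = f :=
  (free_act f _).trans (bind_single f)

/-- The morphism from a free contramodule given by the images of the generators. -/
noncomputable def freeDesc (k : X → C.A) : free R X ⟶ C :=
  homMk (fun f : ConvComb R X => act C f k) fun F =>
    (congrArg (act C · k) (free_act F fun f => f)).trans
      (act_act F (fun f : ConvComb R X => f) k).symm

theorem freeDesc_gen (k : X → C.A) (x : X) : (freeDesc k).f (gen x : (free R X).A) = k x :=
  act_single x k

theorem hom_free_apply (φ : free R X ⟶ C) (f : ConvComb R X) :
    φ.f f = act C f fun x => φ.f (gen x : (free R X).A) :=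
  (congrArg φ.f (act_gen f).symm).trans (hom_act φ f gen)

theorem free_hom_ext {φ ψ : free R X ⟶ C}
    (h : ∀ x, φ.f (gen x : (free R X).A) = ψ.f (gen x : (free R X).A)) : φ = ψ :=
  hom_ext fun f => (hom_free_apply φ f).trans
    ((congrArg (act C _) (funext h)).trans (hom_free_apply ψ f).symm)

end Free

section Quotient

variable {C D : Contramodule R} {X : Type*}

/-- If the differences of the two families are images under `φ` of elements `c x`, the difference of
the combinations is the image of the combination of the `c x`. So the operation on the quotient is
independent of representatives. -/
theorem quotient_act_congr (φ : C ⟶ D) (f : ConvComb R X) {k l : X → D.A}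
    (h : ∀ x, (k x : D.A ⧸ (addHom φ).range) = l x) :
    (act D f k : D.A ⧸ (addHom φ).range) = act D f l := by
  choose c hc using fun x => QuotientAddGroup.eq.1 (h x)
  refine QuotientAddGroup.eq.2 ⟨act C f c, ?_⟩
  refine (hom_act φ f c).trans ?_
  rw [show (fun x => φ.f (c x)) = fun x => -k x + l x from funext hc, act_add_right, act_neg_right]

/-- The cokernel of a morphism of contramodules. -/
noncomputable def coker (φ : C ⟶ D) : Contramodule R :=
  mk (D.A ⧸ (addHom φ).range)
    (fun F => QuotientAddGroup.mk (act D F Quotient.out)) (fun q => by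
      rw [act_single]; exact Quotient.out_eq q) (fun F => by
      rw [← act_act, act_map]
      exact quotient_act_congr φ F fun x => (Quotient.out_eq _).symm)

/-- The projection to the cokernel. -/
noncomputable def cokerπ (φ : C ⟶ D) : D ⟶ coker φ :=
  homMk (fun x => (x : D.A ⧸ (addHom φ).range)) fun f => by
    refine (quotient_act_congr φ f fun x => ?_).trans (congrArg _ (act_map _ _ _).symm)
    exact (Quotient.out_eq _).symm

theorem cokerπ_surjective (φ : C ⟶ D) : Function.Surjective (cokerπ φ).f :=
  QuotientAddGroup.mk_surjective

theorem cokerπ_eq_iff (φ : C ⟶ D) (x y : D.A) :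
    (cokerπ φ).f x = (cokerπ φ).f y ↔ ∃ c, φ.f c = -x + y :=
  QuotientAddGroup.eq

theorem comp_cokerπ (φ : C ⟶ D) : φ ≫ cokerπ φ = 0 := hom_ext fun x =>
  ((cokerπ_eq_iff φ (φ.f x) 0).2 ⟨-x, by rw [hom_neg, add_zero]⟩).trans (hom_zero (cokerπ φ))

theorem epi_of_surjective (φ : C ⟶ D) (h : Function.Surjective φ.f) : Epi φ :=
  (contraMonad R).forget.epi_of_epi_map ((epi_iff_surjective φ.f).2 h)

/-- A surjective morphism is a cokernel of any morphism onto its kernel. -/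
theorem exists_desc_of_surjective {B : Contramodule R} (p : D ⟶ B) (hp : Function.Surjective p.f)
    {W : Contramodule R} (g : D ⟶ W) (h : ∀ x, p.f x = 0 → g.f x = 0) : ∃ k, p ≫ k = g := by
  have key : ∀ x y, p.f x = p.f y → g.f x = g.f y := fun x y hxy => by
    rw [← sub_eq_zero, ← hom_sub]
    exact h _ (by rw [hom_sub, hxy, sub_self])
  let s : B.A → D.A := Function.surjInv hp
  have hs (b : B.A) : p.f (s b) = b := Function.surjInv_eq hp b
  refine ⟨homMk (fun b => g.f (s b)) fun f => ?_, hom_ext fun x => key _ _ (hs _)⟩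
  rw [← hom_act]
  refine key _ _ ?_
  rw [hs, hom_act]
  simp only [hs]

instance : HasCokernels (Contramodule R) where
  has_colimit {C D} φ := by
    have := epi_of_surjective (cokerπ φ) (cokerπ_surjective φ)
    refine ⟨⟨⟨CokernelCofork.ofπ (cokerπ φ) (comp_cokerπ φ),
      CokernelCofork.IsColimit.ofπ' _ _ fun g hg =>
        have := exists_desc_of_surjective (cokerπ φ) (cokerπ_surjective φ) g fun x hx => ?_
        ⟨this.choose, this.choose_spec⟩⟩⟩⟩
    obtain ⟨c, hc⟩ := (cokerπ_eq_iff φ 0 x).1 ((hom_zero _).trans hx.symm)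
    rw [neg_zero, zero_add] at hc
    rw [← hc]
    exact ConcreteCategory.congr_hom (congrArg Monad.Algebra.Hom.f hg) c

theorem injective_of_mono (φ : C ⟶ D) [Mono φ] : Function.Injective φ.f :=
  (mono_iff_injective φ.f).1 (inferInstanceAs (Mono ((contraMonad R).forget.map φ)))

theorem surjective_of_epi (φ : C ⟶ D) [Epi φ] : Function.Surjective φ.f := fun y => by
  have h : cokerπ φ = 0 := by rw [← cancel_epi φ, comp_cokerπ, comp_zero]
  obtain ⟨c, hc⟩ := (cokerπ_eq_iff φ 0 y).1 (by rw [h]; rfl)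
  exact ⟨c, by rw [hc, neg_zero, zero_add]⟩

instance : HasLimitsOfSize.{v, v} (Contramodule R) :=
  ⟨fun _ _ => ⟨fun F => Monad.hasLimit_of_comp_forget_hasLimit F⟩⟩

noncomputable instance : Abelian (Contramodule R) where
  has_finite_products := hasFiniteProducts_of_hasProducts _
  has_kernels :=
    have : HasFiniteLimits (Contramodule R) := hasFiniteLimits_of_hasLimits _
    inferInstance
  has_cokernels := inferInstance
  normalMonoOfMono {C D} φ _ := ⟨
    { Z := coker φ
      g := cokerπ φ
      w := comp_cokerπ φ
      isLimit := KernelFork.IsLimit.ofι' _ _ fun {W} g hg => by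
        have key : ∀ w, ∃ c, φ.f c = g.f w := fun w => by
          obtain ⟨c, hc⟩ := (cokerπ_eq_iff φ 0 (g.f w)).1
            ((hom_zero _).trans
              (ConcreteCategory.congr_hom (congrArg Monad.Algebra.Hom.f hg) w).symm)
          exact ⟨c, by rw [hc, neg_zero, zero_add]⟩
        choose s hs using key
        refine ⟨homMk s fun f => injective_of_mono φ ?_, hom_ext hs⟩
        rw [hs, hom_act, hom_act]
        simp only [hs] }⟩
  normalEpiOfEpi {C D} φ _ :=
    have : HasFiniteLimits (Contramodule R) := hasFiniteLimits_of_hasLimits _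
    ⟨
    { W := kernel φ
      g := kernel.ι φ
      w := kernel.condition φ
      isColimit := CokernelCofork.IsColimit.ofπ' _ _ fun {W} g hg =>
        have h := exists_desc_of_surjective φ (surjective_of_epi φ) g fun x hx => by
          -- The kernel is given only by its universal property; an element `x` killed by `φ` is
          -- brought into it as a morphism from the free contramodule on one generator.
          let d : free R PUnit.{v + 1} ⟶ C := freeDesc fun _ => x
          have hd : d ≫ φ = 0 := free_hom_ext fun u =>
            (congrArg φ.f (freeDesc_gen _ u)).trans hx
          have h0 : d ≫ g = 0 := by rw [← kernel.lift_ι φ d hd, Category.assoc, hg, comp_zero]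
          exact (congrArg g.f (freeDesc_gen (fun _ => x) PUnit.unit)).symm.trans
            (ConcreteCategory.congr_hom (congrArg Monad.Algebra.Hom.f h0)
              (gen PUnit.unit : (free R PUnit).A))
        ⟨h.choose, h.choose_spec⟩ }⟩

instance projective_free (X : Type v) : Projective (free R X) where
  factors f e _ := by
    let s := Function.surjInv (surjective_of_epi e)
    refine ⟨freeDesc fun x => s (f.f (gen x : (free R X).A)), free_hom_ext fun x => ?_⟩
    exact (congrArg e.f (freeDesc_gen _ x)).trans (Function.surjInv_eq _ _)

theorem freeDesc_id_surjective (C : Contramodule R) :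
    Function.Surjective (freeDesc fun x : C.A => x).f :=
  fun x => ⟨(gen x : (free R C.A).A), freeDesc_gen _ _⟩

instance : EnoughProjectives (Contramodule R) where
  presentation C := ⟨
    { p := free R C.A
      f := freeDesc fun x => x
      epi := epi_of_surjective _ (freeDesc_id_surjective C) }⟩

end Quotient

end Contramodule

/-! ### The contramodules `Hom(E, J)` -/

namespace EndOp

variable {A : Type u} [Category.{v} A] [Abelian A] {E : A}

theorem finite_comp_hom_ne_zero {X : Type*} (f : ConvComb (EndOp E) X) {N : A}
    [IsNoetherianObject N] (m : N ⟶ E) : {x | m ≫ (f.1 x).hom ≠ 0}.Finite := by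
  have h := f.2 (hasBasis_nhds_zero.mem_of_mem (isNoetherianObject_imageSubobject m))
  refine Set.Finite.subset h fun x hx h0 => hx ?_
  change _ = _ at h0
  rw [← imageSubobject_arrow_comp m, Category.assoc, h0, comp_zero]

theorem support_comp_hom_comp_subset {X : Type*} (f : ConvComb (EndOp E) X) {N J : A}
    (m : N ⟶ E) (k : X → (E ⟶ J)) :
    (Function.support fun x => m ≫ (f.1 x).hom ≫ k x) ⊆ {x | m ≫ (f.1 x).hom ≠ 0} :=
  fun x hx h0 => hx (by dsimp only; rw [← Category.assoc, h0, zero_comp])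

theorem comp_finsum_comp_hom {X : Type*} (f : ConvComb (EndOp E) X) {N N' J : A}
    [IsNoetherianObject N] (m : N ⟶ E) (k : X → (E ⟶ J)) (n : N' ⟶ N) :
    n ≫ ∑ᶠ x, m ≫ (f.1 x).hom ≫ k x = ∑ᶠ x, (n ≫ m) ≫ (f.1 x).hom ≫ k x := by
  refine (AddMonoidHom.map_finsum (Preadditive.leftComp J n)
    ((finite_comp_hom_ne_zero f m).subset (support_comp_hom_comp_subset f m k))).trans ?_
  exact finsum_congr fun x => (Category.assoc _ _ _).symm

variable [IsLocallyNoetherian A]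

theorem exists_comb {X : Type*} (f : ConvComb (EndOp E) X) {J : A} (k : X → (E ⟶ J)) :
    ∃ φ : E ⟶ J, ∀ M : Subobject E, IsNoetherianObject (M : A) →
      M.arrow ≫ φ = ∑ᶠ x, M.arrow ≫ (f.1 x).hom ≫ k x :=
  exists_glue _ fun M M' _ _ h => by
    rw [comp_finsum_comp_hom, Subobject.ofLE_arrow]

/-- The infinite linear combination `∑ k(x) ∘ f_x` of morphisms `k(x) : E ⟶ J` with coefficients
in `EndOp E` converging to zero. -/
noncomputable def comb {X : Type*} (f : ConvComb (EndOp E) X) {J : A} (k : X → (E ⟶ J)) : E ⟶ J :=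
  (exists_comb f k).choose

theorem comp_comb {X : Type*} (f : ConvComb (EndOp E) X) {J N : A} [IsNoetherianObject N]
    (m : N ⟶ E) (k : X → (E ⟶ J)) : m ≫ comb f k = ∑ᶠ x, m ≫ (f.1 x).hom ≫ k x := by
  have hN := isNoetherianObject_imageSubobject m
  have h := (exists_comb f k).choose_spec _ hN
  change _ ≫ comb f k = _ at h
  rw [← imageSubobject_arrow_comp m, Category.assoc, h, comp_finsum_comp_hom]

theorem comb_single {X : Type*} {J : A} (x : X) (k : X → (E ⟶ J)) :
    comb (ConvComb.single x) k = k x := by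
  refine hom_ext_of_noetherian fun N _ m => ?_
  rw [comp_comb, finsum_eq_single _ x fun y hy => ?_]
  · simp [ConvComb.single_apply]
  · simp [ConvComb.single_apply, hy.symm]

theorem comb_comp {X : Type*} (f : ConvComb (EndOp E) X) {J J' : A} (k : X → (E ⟶ J))
    (g : J ⟶ J') : comb f k ≫ g = comb f fun x => k x ≫ g := by
  refine hom_ext_of_noetherian fun N _ m => ?_
  rw [comp_comb, ← Category.assoc, comp_comb]
  refine (AddMonoidHom.map_finsum (Preadditive.rightComp N g)
    ((finite_comp_hom_ne_zero f m).subset (support_comp_hom_comp_subset f m k))).trans ?_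
  exact finsum_congr fun x => by simp [Preadditive.rightComp]

/-- Restriction to a Noetherian subobject is continuous to a discrete group, so the partial sums
become constant there and the convergent sum restricts to a finite one. -/
theorem comp_tsum_hom {X : Type*} (f : ConvComb (EndOp E) X) {N : A}
    [IsNoetherianObject N] (m : N ⟶ E) : m ≫ (∑' x, f.1 x).hom = ∑ᶠ x, m ≫ (f.1 x).hom := by
  have key : (∑' x, f.1 x).hom = comb f fun _ => 𝟙 E := by
    refine hom_ext_of_noetherianSubobject fun M hM => ?_
    have hs := (ConvComb.summable f.2).hasSum
    have h1 : ∀ᶠ F : Finset X in atTop, M.arrow ≫ (∑ x ∈ F, f.1 x).hom =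
        M.arrow ≫ (∑' x, f.1 x).hom := hs ((hasBasis_nhds _).mem_of_mem hM)
    obtain ⟨F, hF, hF'⟩ := (h1.and
      (eventually_ge_atTop (finite_comp_hom_ne_zero f M.arrow).toFinset)).exists
    rw [comp_comb, ← hF, finsum_eq_sum_of_support_subset (s := F)]
    · rw [← Preadditive.comp_sum]
      simp only [Category.comp_id]
      exact congrArg _ (map_sum homEquiv f.1 F)
    · refine (support_comp_hom_comp_subset f M.arrow _).trans fun x hx => hF' ?_
      simpa using hx
  rw [key, comp_comb]
  simp only [Category.comp_id]

/-- On a Noetherian object only the `x` in a finite set `S` matter, and for each of them only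
finitely many `y`. Associativity reduces to exchanging two finite sums. -/
theorem comb_bind {X Y : Type*} (f : ConvComb (EndOp E) X) (g : X → ConvComb (EndOp E) Y) {J : A}
    (k : Y → (E ⟶ J)) : comb (ConvComb.bind f g) k = comb f fun x => comb (g x) k := by
  classical
  refine hom_ext_of_noetherian fun N _ m => ?_
  let S := (finite_comp_hom_ne_zero f m).toFinset
  let T := S.biUnion fun x => (finite_comp_hom_ne_zero (g x) (m ≫ (f.1 x).hom)).toFinset
  have h0 : ∀ x y, (x ∉ S ∨ y ∉ T) → m ≫ (f.1 x).hom ≫ ((g x).1 y).hom = 0 := by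
    intro x y h
    by_cases hx : x ∈ S
    · have hy := h.resolve_left (not_not.2 hx)
      by_contra hne
      refine hy (Finset.mem_biUnion.2 ⟨x, hx, ?_⟩)
      simpa using hne
    · have : m ≫ (f.1 x).hom = 0 := by simpa [S] using hx
      rw [← Category.assoc, this, zero_comp]
  have h1 (y : Y) : m ≫ ((ConvComb.bind f g).1 y).hom =
      ∑ x ∈ S, m ≫ (f.1 x).hom ≫ ((g x).1 y).hom := by
    have hc : Tendsto (fun x => f.1 x * (g x).1 y) cofinite (𝓝 0) := by
      have h := (ConvComb.tendsto_opening f.2 (fun x => (g x).2) fun _ => 1).comp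
        (Function.Injective.tendsto_cofinite (f := fun x : X => (x, y))
          fun _ _ h => (Prod.mk.inj h).1)
      simpa only [Function.comp_def, mul_one] using h
    refine (comp_tsum_hom ⟨_, hc⟩ m).trans (finsum_eq_sum_of_support_subset _ fun x hx => ?_)
    by_contra hxS
    exact hx (h0 x y (Or.inl hxS))
  rw [comp_comb, comp_comb]
  have hl : ∑ᶠ y, m ≫ ((ConvComb.bind f g).1 y).hom ≫ k y =
      ∑ y ∈ T, ∑ x ∈ S, m ≫ (f.1 x).hom ≫ ((g x).1 y).hom ≫ k y := by
    rw [finsum_eq_sum_of_support_subset (s := T)]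
    · refine Finset.sum_congr rfl fun y _ => ?_
      rw [← Category.assoc, h1, Preadditive.sum_comp]
      simp only [Category.assoc]
    · intro y hy
      by_contra hyT
      refine hy ?_
      dsimp only
      rw [← Category.assoc, h1, Finset.sum_eq_zero fun x _ => h0 x y (Or.inr hyT), zero_comp]
  have hr : ∑ᶠ x, m ≫ (f.1 x).hom ≫ comb (g x) k =
      ∑ x ∈ S, ∑ y ∈ T, m ≫ (f.1 x).hom ≫ ((g x).1 y).hom ≫ k y := by
    rw [finsum_eq_sum_of_support_subset (s := S)]
    · refine Finset.sum_congr rfl fun x _ => ?_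
      rw [← Category.assoc, comp_comb, finsum_eq_sum_of_support_subset (s := T)]
      · simp only [Category.assoc]
      · intro y hy
        by_contra hyT
        refine hy ?_
        have := h0 x y (Or.inr hyT)
        dsimp only
        rw [Category.assoc, reassoc_of% this, zero_comp]
    · refine (support_comp_hom_comp_subset f m _).trans fun x hx => ?_
      simpa [S] using hx
  rw [hl, hr, Finset.sum_comm]

variable (E) in
/-- The contramodule over `EndOp E` of morphisms from `E`. -/
noncomputable def homContramodule (J : A) : Contramodule (EndOp E) :=
  Contramodule.mk (E ⟶ J) (fun F => comb F fun k => k) (fun k => comb_single k _) fun F => by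
    rw [comb_bind, ConvComb.map, comb_bind]
    simp only [comb_single]

theorem act_homContramodule {J : A} {X : Type*} (f : ConvComb (EndOp E) X) (k : X → (E ⟶ J)) :
    Contramodule.act (homContramodule E J) f k = comb f k := by
  refine (Contramodule.mk_act _ _ _ _ _ _).trans ?_
  rw [ConvComb.map, comb_bind]
  exact congrArg (comb f) (funext fun x => comb_single (k x) fun k => k)

variable (E) in
/-- The functor taking `J` to the contramodule of morphisms `E ⟶ J`. -/
noncomputable def homFunctor : A ⥤ Contramodule (EndOp E) where
  obj J := homContramodule E J
  map {J J'} g := Contramodule.homMk (fun k : E ⟶ J => (k ≫ g : E ⟶ J')) fun f => by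
    refine (congrArg (· ≫ g) (act_homContramodule f fun k : E ⟶ J => k)).trans ?_
    exact (comb_comp f _ g).trans (act_homContramodule f _).symm
  map_id J := Contramodule.hom_ext fun k => Category.comp_id (X := E) (Y := J) k
  map_comp {J _ _} g h := Contramodule.hom_ext fun k =>
    (Category.assoc (W := E) (X := J) k g h).symm

theorem hom_comb {J : A} {D : Contramodule (EndOp E)} (φ : (homFunctor E).obj J ⟶ D) {X : Type*}
    (f : ConvComb (EndOp E) X) (k : X → (E ⟶ J)) :
    φ.f (comb f k : E ⟶ J) = Contramodule.act D f fun x => φ.f (k x) :=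
  (congrArg φ.f (act_homContramodule f k).symm).trans (Contramodule.hom_act φ f k)

/-- Every morphism from `E` to a coproduct of copies of `E` is an infinite linear combination of
the inclusions. -/
theorem exists_comb_ι_eq {X : Type v} (h : E ⟶ ∐ fun _ : X => E) :
    ∃ f : ConvComb (EndOp E) X, comb f (Sigma.ι fun _ : X => E) = h := by
  classical
  have key {N : A} [IsNoetherianObject N] (m : N ⟶ E) : ∃ F : Finset X,
      m ≫ h = (∑ x ∈ F, m ≫ (h ≫ Sigma.π _ x) ≫ Sigma.ι (fun _ : X => E) x) ∧
        ∀ x ∉ F, m ≫ h ≫ Sigma.π _ x = 0 := by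
    obtain ⟨F, hF⟩ := exists_finset_sum_comp_π_ι _ (m ≫ h)
    simp only [Category.assoc] at hF
    refine ⟨F, by simpa only [Category.assoc] using hF, fun x hx => ?_⟩
    rw [← Category.assoc, hF, Preadditive.sum_comp]
    refine Finset.sum_eq_zero fun y hy => ?_
    simp only [Category.assoc]
    rw [Sigma.ι_π_of_ne _ (by rintro rfl; exact hx hy)]
    simp only [comp_zero]
  -- The components of `h` tend to zero because `h` maps each Noetherian subobject into finitely
  -- many summands.
  have hlim : Tendsto (fun x => of (h ≫ Sigma.π (fun _ : X => E) x)) cofinite (𝓝 0) := by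
    refine hasBasis_nhds_zero.tendsto_right_iff.2 fun M hM => ?_
    obtain ⟨F, -, hF⟩ := key M.arrow
    refine F.finite_toSet.subset fun x hx => ?_
    by_contra hxF
    exact hx (hF x hxF)
  let f : ConvComb (EndOp E) X := ⟨_, hlim⟩
  refine ⟨f, hom_ext_of_noetherian fun N _ m => ?_⟩
  obtain ⟨F, hF, hF'⟩ := key m
  rw [comp_comb, hF]
  refine finsum_eq_sum_of_support_subset _ fun x hx => ?_
  by_contra hxF
  have := hF' x hxF
  refine hx ?_
  dsimp only
  change m ≫ (h ≫ Sigma.π _ x) ≫ _ = 0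
  rw [← Category.assoc, this, zero_comp]

theorem comb_ι_injective {X : Type v} :
    Function.Injective fun f : ConvComb (EndOp E) X => comb f (Sigma.ι fun _ : X => E) := by
  classical
  have key (f : ConvComb (EndOp E) X) (x : X) :
      comb f (Sigma.ι fun _ : X => E) ≫ Sigma.π _ x = (f.1 x).hom := by
    rw [comb_comp]
    refine hom_ext_of_noetherian fun N _ m => ?_
    rw [comp_comb, finsum_eq_single _ x fun y hy => by
      rw [Sigma.ι_π_of_ne _ hy, comp_zero, comp_zero]]
    rw [Sigma.ι_π_eq_id, Category.comp_id]
  intro f g h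
  refine ConvComb.ext fun x => hom_injective ?_
  rw [← key, ← key]
  exact congrArg (· ≫ _) h

variable (E) in
/-- The canonical morphism from the free contramodule. -/
noncomputable def freeToHom (X : Type v) :
    Contramodule.free (EndOp E) X ⟶ (homFunctor E).obj (∐ fun _ : X => E) :=
  Contramodule.freeDesc (C := (homFunctor E).obj (∐ fun _ : X => E)) (Sigma.ι fun _ : X => E)

instance (X : Type v) : IsIso (freeToHom E X) := by
  have h (f : ConvComb (EndOp E) X) : (freeToHom E X).f f = comb f (Sigma.ι fun _ : X => E) :=
    act_homContramodule f _
  have : Epi (freeToHom E X) := Contramodule.epi_of_surjective _ fun k => by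
    obtain ⟨f, hf⟩ := exists_comb_ι_eq (X := X) k
    exact ⟨f, (h f).trans hf⟩
  have : Mono (freeToHom E X) := (contraMonad (EndOp E)).forget.mono_of_mono_map
    ((mono_iff_injective (freeToHom E X).f).2 fun f g hfg =>
      comb_ι_injective ((h f).symm.trans (hfg.trans (h g))))
  exact isIso_of_mono_of_epi _

theorem homFunctor_map_injective {X : Type v} {J J' : A} (ρ : Retract J (∐ fun _ : X => E))
    {g g' : J ⟶ J'} (h : (homFunctor E).map g = (homFunctor E).map g') : g = g' := by
  have key : ρ.r ≫ g = ρ.r ≫ g' := Sigma.hom_ext _ _ fun x => by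
    have := ConcreteCategory.congr_hom (congrArg Monad.Algebra.Hom.f h)
      (Sigma.ι (fun _ : X => E) x ≫ ρ.r : E ⟶ J)
    rw [← Category.assoc, ← Category.assoc]
    exact this
  rw [← Category.id_comp g, ← Category.id_comp g', ← ρ.retract, Category.assoc, Category.assoc, key]

/-- The coproduct inclusions determine a candidate morphism in `A`. It induces `φ` because every `E
⟶ J` is an infinite combination of inclusions followed by `ρ.r`, and `φ` preserves such
combinations. -/
theorem homFunctor_map_surjective {X : Type v} {J J' : A} (ρ : Retract J (∐ fun _ : X => E))
    (φ : (homFunctor E).obj J ⟶ (homFunctor E).obj J') : ∃ g, (homFunctor E).map g = φ := by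
  let ψ : (∐ fun _ : X => E) ⟶ J' :=
    Limits.Sigma.desc fun x => (φ.f (Sigma.ι (fun _ : X => E) x ≫ ρ.r : E ⟶ J) : E ⟶ J')
  refine ⟨ρ.i ≫ ψ, Contramodule.hom_ext fun k => ?_⟩
  change E ⟶ J at k
  obtain ⟨f, hf⟩ := exists_comb_ι_eq (k ≫ ρ.i)
  have h₁ : k ≫ ρ.i ≫ ψ =
      comb f fun x => (φ.f (Sigma.ι (fun _ : X => E) x ≫ ρ.r : E ⟶ J) : E ⟶ J') := by
    rw [← Category.assoc, ← hf, comb_comp]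
    exact congrArg (comb f) (funext fun x => Sigma.ι_desc _ _)
  have h₂ : k = comb f fun x => Sigma.ι (fun _ : X => E) x ≫ ρ.r := by
    rw [← comb_comp, hf, Category.assoc, ρ.retract, Category.comp_id]
  exact h₁.trans ((act_homContramodule f _).symm.trans
    ((hom_comb φ f _).symm.trans (congrArg φ.f h₂.symm)))

end EndOp

/-! ### Injective objects and projective contramodules -/

section Equivalence

variable {A : Type u} [Category.{v} A] [Abelian A] [IsLocallyNoetherian A] {E : A}

namespace GeneratesInjectives

theorem exists_retract_sigma (hE : GeneratesInjectives E) (J : A) [hJ : Injective J] :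
    ∃ X : Type v, Nonempty (Retract J (∐ fun _ : X => E)) := by
  obtain ⟨X, c, ⟨hc⟩, ⟨ρ⟩⟩ := hE.exists_retract J hJ
  exact ⟨X, ⟨ρ.trans (Retract.ofIso (hc.coconePointUniqueUpToIso (coproductIsCoproduct _)))⟩⟩

theorem projective_homFunctor_obj (hE : GeneratesInjectives E) (J : A) [Injective J] :
    Projective ((EndOp.homFunctor E).obj J) := by
  obtain ⟨X, ⟨ρ⟩⟩ := hE.exists_retract_sigma J
  have : Projective ((EndOp.homFunctor E).obj (∐ fun _ : X => E)) :=
    Projective.of_iso (asIso (EndOp.freeToHom E X)) inferInstance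
  exact (ρ.map (EndOp.homFunctor E)).projective

/-- The functor from injective objects to projective contramodules. -/
noncomputable def functor (hE : GeneratesInjectives E) :
    InjectiveObject A ⥤ ProjectiveObject (Contramodule (EndOp E)) :=
  ObjectProperty.lift _ (InjectiveObject.ι A ⋙ EndOp.homFunctor E) fun J =>
    hE.projective_homFunctor_obj J.obj

instance (hE : GeneratesInjectives E) : hE.functor.Faithful where
  map_injective {J J'} g g' h := by
    obtain ⟨X, ⟨ρ⟩⟩ := hE.exists_retract_sigma J.obj
    refine (InjectiveObject.ι A).map_injective (EndOp.homFunctor_map_injective ρ ?_)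
    exact congrArg (isProjective _).ι.map h

instance (hE : GeneratesInjectives E) : hE.functor.Full where
  map_surjective {J J'} φ := by
    obtain ⟨X, ⟨ρ⟩⟩ := hE.exists_retract_sigma J.obj
    obtain ⟨g, hg⟩ := EndOp.homFunctor_map_surjective ρ ((isProjective _).ι.map φ)
    exact ⟨(InjectiveObject.ι A).preimage g, (isProjective _).ι.map_injective
      ((congrArg (EndOp.homFunctor E).map ((InjectiveObject.ι A).map_preimage g)).trans hg)⟩

instance (hE : GeneratesInjectives E) : hE.functor.EssSurj where
  mem_essImage P := by
    have := P.2
    have := hE.injective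
    let R := EndOp E
    let X := P.obj.A
    let p : Contramodule.free R X ⟶ P.obj := Contramodule.freeDesc fun x => x
    have hp : Epi p := Contramodule.epi_of_surjective _ (Contramodule.freeDesc_id_surjective _)
    let s : P.obj ⟶ Contramodule.free R X := Projective.factorThru (𝟙 _) p
    have hs : s ≫ p = 𝟙 _ := Projective.factorThru_comp _ _
    let Φ := asIso (EndOp.freeToHom E X)
    have ρ : Retract (∐ fun _ : X => E) (∐ fun _ : X => E) := Retract.refl _
    -- The projective contramodule is the image of an idempotent of a free one. By full faithfulness
    -- this idempotent comes from a coproduct of copies of `E`, where it splits; the splitting is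
    -- the required injective.
    obtain ⟨e, he⟩ := EndOp.homFunctor_map_surjective ρ (Φ.inv ≫ p ≫ s ≫ Φ.hom)
    have hee : e ≫ e = e := EndOp.homFunctor_map_injective ρ (by
      rw [Functor.map_comp, he]
      simp [reassoc_of% hs])
    obtain ⟨J, i, r, hir, hri⟩ := IsIdempotentComplete.idempotents_split _ e hee
    have hJ : Injective J := by
      have : Injective (∐ fun _ : X => E) := injective_sigma _
      exact Retract.injective ⟨i, r, hir⟩
    let K := EndOp.homFunctor E
    have hKir : K.map i ≫ K.map r = 𝟙 _ := by rw [← K.map_comp, hir, K.map_id]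
    have hKri : K.map r ≫ K.map i = Φ.inv ≫ p ≫ s ≫ Φ.hom := by rw [← K.map_comp, hri, he]
    let α : K.obj J ≅ P.obj :=
      { hom := K.map i ≫ Φ.inv ≫ p
        inv := s ≫ Φ.hom ≫ K.map r
        hom_inv_id := by
          have h : K.map i ≫ Φ.inv ≫ p ≫ s ≫ Φ.hom ≫ K.map r =
              K.map i ≫ (Φ.inv ≫ p ≫ s ≫ Φ.hom) ≫ K.map r := by simp only [Category.assoc]
          simp only [Category.assoc]
          rw [h, ← hKri, Category.assoc, hKir, Category.comp_id, hKir]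
        inv_hom_id := by
          simp only [Category.assoc]
          rw [reassoc_of% hKri]
          simp [hs] }
    exact ⟨⟨J, hJ⟩, ⟨(isProjective _).isoMk α⟩⟩

instance (hE : GeneratesInjectives E) : hE.functor.IsEquivalence where

end GeneratesInjectives

end Equivalence

/-! ### Presentations by projective objects -/

section Presentations

universe w

variable {P : Type u} [Category.{v} P] [Preadditive P]

/-- A fully faithful additive functor to projective objects, of which every object is a
quotient. -/
structure IsProjectiveGenerating {B : Type u₁} [Category.{v₁} B] [Abelian B] (G : P ⥤ B) :
    Prop where
  full : G.Full
  faithful : G.Faithful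
  additive : G.Additive
  projective (p : P) : Projective (G.obj p)
  exists_epi (b : B) : ∃ (p : P) (f : G.obj p ⟶ b), Epi f

/-- The morphism `π` is a weak cokernel of `G.map f` which is an epimorphism, and morphisms `x` with
`G.map x ≫ π = 0` factor through `f`. -/
structure IsPresentation {B : Type u₁} [Category.{v₁} B] [Abelian B] (G : P ⥤ B) {p q : P}
    (f : p ⟶ q) {b : B} (π : G.obj q ⟶ b) : Prop where
  epi : Epi π
  map_comp : G.map f ≫ π = 0
  exists_lift {t : P} (x : t ⟶ q) : G.map x ≫ π = 0 → ∃ y : t ⟶ p, y ≫ f = x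
  exists_desc {b' : B} (g : G.obj q ⟶ b') : G.map f ≫ g = 0 → ∃ h : b ⟶ b', π ≫ h = g

variable {B : Type u₁} [Category.{v₁} B] [Abelian B] {G : P ⥤ B}

namespace IsProjectiveGenerating

theorem exists_comp_eq (hG : IsProjectiveGenerating G) {q t : P} {b : B} (π : G.obj q ⟶ b)
    [Epi π] (x : G.obj t ⟶ b) : ∃ y : t ⟶ q, G.map y ≫ π = x := by
  have := hG.projective t
  have := hG.full
  exact ⟨G.preimage (Projective.factorThru x π), by simp⟩

theorem exists_isPresentation (hG : IsProjectiveGenerating G) (b : B) :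
    ∃ (p q : P) (f : p ⟶ q) (π : G.obj q ⟶ b), IsPresentation G f π := by
  have := hG.full
  have := hG.faithful
  obtain ⟨q, π, hπ⟩ := hG.exists_epi b
  obtain ⟨p, ρ, hρ⟩ := hG.exists_epi (kernel π)
  refine ⟨p, q, G.preimage (ρ ≫ kernel.ι π), π, hπ, by simp, fun {t} x hx => ?_,
    fun g hg => ?_⟩
  · obtain ⟨y, hy⟩ := hG.exists_comp_eq ρ (kernel.lift π _ hx)
    refine ⟨y, G.map_injective ?_⟩
    rw [G.map_comp, G.map_preimage, ← Category.assoc, hy, kernel.lift_ι]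
  · rw [G.map_preimage, Category.assoc] at hg
    exact ⟨Abelian.epiDesc π g (zero_of_epi_comp ρ hg), by simp⟩

/-- A morphism killed by the cokernel lifts to the source of `G.map f` after an epimorphic
refinement, and projectivity of `G.obj t` splits the refinement. -/
theorem isPresentation_cokernel (hG : IsProjectiveGenerating G) {p q : P} (f : p ⟶ q) :
    IsPresentation G f (cokernel.π (G.map f)) := by
  have := hG.full
  have := hG.faithful
  refine ⟨inferInstance, by simp, fun {t} x hx => ?_, fun g hg => ⟨cokernel.desc _ g hg, by simp⟩⟩
  have := hG.projective t
  obtain ⟨A', ρ, hρ, x', hx'⟩ :=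
    (CokernelCofork.IsColimit.comp_π_eq_zero_iff_up_to_refinements
      (cokernelIsCokernel (G.map f)) (G.map x)).1 hx
  refine ⟨G.preimage (Projective.factorThru (𝟙 _) ρ ≫ x'), G.map_injective ?_⟩
  rw [G.map_comp, G.map_preimage, Category.assoc, ← hx', ← Category.assoc,
    Projective.factorThru_comp, Category.id_comp]

end IsProjectiveGenerating

theorem IsPresentation.map_comp_eq_iff (hG : IsProjectiveGenerating G) {p q : P} {f : p ⟶ q}
    {b : B} {π : G.obj q ⟶ b} (h : IsPresentation G f π) {t : P} (x y : t ⟶ q) :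
    G.map x ≫ π = G.map y ≫ π ↔ ∃ z : t ⟶ p, z ≫ f = x - y := by
  have := hG.additive
  constructor
  · exact fun hxy => h.exists_lift _ (by rw [G.map_sub, Preadditive.sub_comp, hxy, sub_self])
  · rintro ⟨z, hz⟩
    rw [← sub_eq_zero, ← Preadditive.sub_comp, ← G.map_sub, ← hz, G.map_comp, Category.assoc,
      h.map_comp, comp_zero]

variable (G) in
/-- The functor taking an object `b` to the presheaf `p ↦ Hom(G p, b)`. -/
def restrictedYoneda : B ⥤ Pᵒᵖ ⥤ Type (max w v₁) :=
  uliftYoneda.{w} ⋙ (Functor.whiskeringLeft _ _ _).obj G.op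

theorem IsProjectiveGenerating.full_restrictedYoneda (hG : IsProjectiveGenerating G) :
    (restrictedYoneda.{v, u, v₁, u₁, w} G).Full where
  map_surjective {b b'} θ := by
    have := hG.additive
    obtain ⟨p, q, f, π, h⟩ := hG.exists_isPresentation b
    have := h.epi
    let φ (t : P) (x : G.obj t ⟶ b) : G.obj t ⟶ b' := ((θ.app (.op t)) (ULift.up x)).down
    have hφ {s t : P} (y : s ⟶ t) (x : G.obj t ⟶ b) : φ s (G.map y ≫ x) = G.map y ≫ φ t x :=
      congrArg ULift.down (ConcreteCategory.congr_hom (θ.naturality y.op)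
        (ULift.up.{w} x : ULift.{w} (G.obj t ⟶ b)))
    -- A map of presheaves of sets is not assumed to preserve zero; naturality along a zero morphism
    -- gives it.
    have h0 : φ p 0 = 0 := by
      have := hφ (0 : p ⟶ q) π
      simpa using this
    obtain ⟨g, hg⟩ := h.exists_desc (φ q π) (by rw [← hφ, h.map_comp, h0])
    refine ⟨g, ?_⟩
    ext ⟨t⟩ ⟨x⟩
    obtain ⟨y, rfl⟩ := hG.exists_comp_eq π x
    refine ULift.down_injective ?_
    refine Eq.trans (b := (G.map y ≫ π) ≫ g) rfl ?_
    rw [Category.assoc, hg]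
    exact (hφ y π).symm

theorem IsProjectiveGenerating.faithful_restrictedYoneda (hG : IsProjectiveGenerating G) :
    (restrictedYoneda.{v, u, v₁, u₁, w} G).Faithful where
  map_injective {b b'} f g hfg := by
    obtain ⟨q, π, hπ⟩ := hG.exists_epi b
    rw [← cancel_epi π]
    exact congrArg ULift.down
      (ConcreteCategory.congr_hom (NatTrans.congr_app hfg (.op q))
        (ULift.up.{w} π : ULift.{w} (G.obj q ⟶ b)))

end Presentations

/-! ### Uniqueness of the abelian category -/

section Uniqueness

variable {P : Type u} [Category.{v} P] [Preadditive P]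
  {B₁ : Type u₁} [Category.{v₁} B₁] [Abelian B₁] {B₂ : Type u₂} [Category.{v₂} B₂] [Abelian B₂]
  {G₁ : P ⥤ B₁} {G₂ : P ⥤ B₂}

/-- Both sides are the quotient of `t ⟶ q` by the relation that the difference factors through `f`,
which does not mention `G₁` or `G₂`. -/
theorem IsPresentation.exists_equiv (h₁ : IsProjectiveGenerating G₁)
    (h₂ : IsProjectiveGenerating G₂) {p q : P} {f : p ⟶ q} {b₁ : B₁} {b₂ : B₂}
    {π₁ : G₁.obj q ⟶ b₁} {π₂ : G₂.obj q ⟶ b₂} (hπ₁ : IsPresentation G₁ f π₁)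
    (hπ₂ : IsPresentation G₂ f π₂) (t : P) :
    ∃ φ : (G₁.obj t ⟶ b₁) ≃ (G₂.obj t ⟶ b₂),
      ∀ y : t ⟶ q, φ (G₁.map y ≫ π₁) = G₂.map y ≫ π₂ := by
  have := hπ₁.epi
  have := hπ₂.epi
  choose y₁ hy₁ using fun x : G₁.obj t ⟶ b₁ => h₁.exists_comp_eq π₁ x
  choose y₂ hy₂ using fun x : G₂.obj t ⟶ b₂ => h₂.exists_comp_eq π₂ x
  have key (x y : t ⟶ q) : G₁.map x ≫ π₁ = G₁.map y ≫ π₁ ↔ G₂.map x ≫ π₂ = G₂.map y ≫ π₂ :=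
    (hπ₁.map_comp_eq_iff h₁ x y).trans (hπ₂.map_comp_eq_iff h₂ x y).symm
  exact ⟨⟨fun x => G₂.map (y₁ x) ≫ π₂, fun x => G₁.map (y₂ x) ≫ π₁,
    fun x => ((key _ _).2 (hy₂ _)).trans (hy₁ x), fun x => ((key _ _).1 (hy₁ _)).trans (hy₂ x)⟩,
    fun y => (key _ _).1 (hy₁ _)⟩

theorem IsPresentation.nonempty_restrictedYoneda_iso (h₁ : IsProjectiveGenerating G₁)
    (h₂ : IsProjectiveGenerating G₂) {p q : P} {f : p ⟶ q} {b₁ : B₁} {b₂ : B₂}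
    {π₁ : G₁.obj q ⟶ b₁} {π₂ : G₂.obj q ⟶ b₂} (hπ₁ : IsPresentation G₁ f π₁)
    (hπ₂ : IsPresentation G₂ f π₂) :
    Nonempty ((restrictedYoneda.{v, u, v₁, u₁, v₂} G₁).obj b₁ ≅
      (restrictedYoneda.{v, u, v₂, u₂, v₁} G₂).obj b₂) := by
  have := hπ₁.epi
  choose φ hφ using fun t => hπ₁.exists_equiv h₁ h₂ hπ₂ t
  refine ⟨NatIso.ofComponents (fun t =>
    (Equiv.ulift.trans ((φ t.unop).trans Equiv.ulift.symm)).toIso) ?_⟩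
  rintro ⟨t⟩ ⟨s⟩ g
  ext ⟨x⟩
  obtain ⟨y, rfl⟩ := h₁.exists_comp_eq π₁ x
  refine ULift.down_injective ?_
  refine Eq.trans (b := φ s (G₁.map g.unop ≫ G₁.map y ≫ π₁)) rfl ?_
  refine Eq.trans ?_ (b := G₂.map g.unop ≫ φ t (G₁.map y ≫ π₁)) rfl
  rw [hφ, ← Category.assoc, ← G₁.map_comp, hφ, G₂.map_comp, Category.assoc]

theorem IsProjectiveGenerating.exists_restrictedYoneda_iso (h₁ : IsProjectiveGenerating G₁)
    (h₂ : IsProjectiveGenerating G₂) (b₁ : B₁) : ∃ b₂ : B₂,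
      Nonempty ((restrictedYoneda.{v, u, v₁, u₁, v₂} G₁).obj b₁ ≅
      (restrictedYoneda.{v, u, v₂, u₂, v₁} G₂).obj b₂) := by
  obtain ⟨p, q, f, π, h⟩ := h₁.exists_isPresentation b₁
  exact ⟨_, h.nonempty_restrictedYoneda_iso h₁ h₂ (h₂.isPresentation_cokernel f)⟩

/-- Both sides are the Yoneda embedding of `P`. -/
noncomputable def restrictedYonedaCompIso (h₁ : IsProjectiveGenerating G₁)
    (h₂ : IsProjectiveGenerating G₂) :
    G₁ ⋙ restrictedYoneda.{v, u, v₁, u₁, v₂} G₁ ≅ G₂ ⋙ restrictedYoneda.{v, u, v₂, u₂, v₁} G₂ :=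
  haveI := h₁.full
  haveI := h₁.faithful
  haveI := h₂.full
  haveI := h₂.faithful
  let φ (s t : P) : (G₁.obj s ⟶ G₁.obj t) ≃ (G₂.obj s ⟶ G₂.obj t) :=
    (Functor.FullyFaithful.ofFullyFaithful G₁).homEquiv.symm.trans
      (Functor.FullyFaithful.ofFullyFaithful G₂).homEquiv
  NatIso.ofComponents (fun t => NatIso.ofComponents (fun s =>
      (Equiv.ulift.trans ((φ s.unop t).trans Equiv.ulift.symm)).toIso) (by
        rintro ⟨s⟩ ⟨s'⟩ g
        ext ⟨x⟩
        obtain ⟨x, rfl⟩ := G₁.map_surjective x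
        refine ULift.down_injective ?_
        refine Eq.trans (b := G₂.map (G₁.preimage (G₁.map g.unop ≫ G₁.map x))) rfl ?_
        refine Eq.trans ?_ (b := G₂.map g.unop ≫ G₂.map (G₁.preimage (G₁.map x))) rfl
        rw [← G₁.map_comp, G₁.preimage_map, G₁.preimage_map, G₂.map_comp])) (by
    intro t t' g
    ext ⟨s⟩ ⟨x⟩
    obtain ⟨x, rfl⟩ := G₁.map_surjective x
    refine ULift.down_injective ?_
    refine Eq.trans (b := G₂.map (G₁.preimage (G₁.map x ≫ G₁.map g))) rfl ?_
    refine Eq.trans ?_ (b := G₂.map (G₁.preimage (G₁.map x)) ≫ G₂.map g) rfl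
    rw [← G₁.map_comp, G₁.preimage_map, G₁.preimage_map, G₂.map_comp])

/-- An abelian category with enough projectives is determined by its projective objects. -/
theorem IsProjectiveGenerating.exists_equivalence (h₁ : IsProjectiveGenerating G₁)
    (h₂ : IsProjectiveGenerating G₂) : ∃ F : B₁ ≌ B₂, Nonempty (G₁ ⋙ F.functor ≅ G₂) := by
  -- The crossed universe lifts make both functors land in the same presheaf category, where their
  -- essential images coincide.
  let H₁ := restrictedYoneda.{v, u, v₁, u₁, v₂} G₁
  let H₂ := restrictedYoneda.{v, u, v₂, u₂, v₁} G₂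
  have : H₁.Full := h₁.full_restrictedYoneda
  have : H₁.Faithful := h₁.faithful_restrictedYoneda
  have : H₂.Full := h₂.full_restrictedYoneda
  have : H₂.Faithful := h₂.faithful_restrictedYoneda
  have hmem (b₁ : B₁) : H₂.essImage (H₁.obj b₁) := by
    obtain ⟨b₂, ⟨e⟩⟩ := h₁.exists_restrictedYoneda_iso h₂ b₁
    exact ⟨b₂, ⟨e.symm⟩⟩
  let K := ObjectProperty.lift H₂.essImage H₁ hmem
  have : K.EssSurj := ⟨by
    rintro ⟨Y, b₂, ⟨e⟩⟩
    obtain ⟨b₁, ⟨e'⟩⟩ := h₂.exists_restrictedYoneda_iso h₁ b₂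
    exact ⟨b₁, ⟨H₂.essImage.isoMk (e'.symm ≪≫ e)⟩⟩⟩
  have : K.IsEquivalence := {}
  let F := K.asEquivalence.trans H₂.toEssImage.asEquivalence.symm
  let i : F.functor ⋙ H₂ ≅ H₁ :=
    Functor.isoWhiskerRight (Functor.isoWhiskerLeft K H₂.toEssImage.asEquivalence.counitIso)
      H₂.essImage.ι
  exact ⟨F, ⟨Functor.fullyFaithfulCancelRight H₂
    (Functor.isoWhiskerLeft G₁ i ≪≫ restrictedYonedaCompIso h₁ h₂)⟩⟩

end Uniqueness

theorem CategoryTheory.Equivalence.additive_functor {C : Type u₁} [Category.{v₁} C]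
    [Preadditive C] [HasBinaryProducts C] {D : Type u₂} [Category.{v₂} D] [Preadditive D]
    (e : C ≌ D) : e.functor.Additive :=
  Functor.additive_of_preserves_binary_products _

theorem isProjectiveGenerating_of_equivalence {P : Type u} [Category.{v} P] [Preadditive P]
    [HasBinaryProducts P] {B : Type u₁} [Category.{v₁} B] [Abelian B] [EnoughProjectives B]
    (e : P ≌ ProjectiveObject B) :
    IsProjectiveGenerating (e.functor ⋙ (isProjective B).ι) where
  full := inferInstance
  faithful := inferInstance
  additive := by
    have := e.additive_functor
    infer_instance
  projective p := (e.functor.obj p).property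
  exists_epi b := by
    let i := e.counitIso.app ⟨Projective.over b, inferInstanceAs (Projective _)⟩
    exact ⟨e.inverse.obj ⟨Projective.over b, inferInstanceAs (Projective _)⟩,
      (isProjective B).ι.map i.hom ≫ Projective.π b, epi_comp _ _⟩

/-! ### Coproducts and products through presentations -/

namespace IsProjectiveGenerating

variable {P : Type u} [Category.{v} P] [Preadditive P] {B : Type u₁} [Category.{v₁} B] [Abelian B]
  {G : P ⥤ B} {ι : Type v₂}

/-- Lifting both morphisms to `q`, their difference factors through `f` on each summand; the
factorizations assemble over the coproduct in `P`. -/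
theorem eq_of_cofan (hG : IsProjectiveGenerating G) {K : Discrete ι ⥤ P} {c : Cocone K}
    (hc : IsColimit c) {b : B} {g h : G.obj c.pt ⟶ b}
    (hgh : ∀ j, G.map (c.ι.app j) ≫ g = G.map (c.ι.app j) ≫ h) : g = h := by
  obtain ⟨p, q, f, π, hπ⟩ := hG.exists_isPresentation b
  have := hπ.epi
  obtain ⟨x, rfl⟩ := hG.exists_comp_eq π g
  obtain ⟨y, rfl⟩ := hG.exists_comp_eq π h
  rw [hπ.map_comp_eq_iff hG]
  have hz (j : Discrete ι) : ∃ z : K.obj j ⟶ p, z ≫ f = c.ι.app j ≫ x - c.ι.app j ≫ y := by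
    rw [← hπ.map_comp_eq_iff hG]
    simpa using hgh j
  choose z hz using hz
  refine ⟨hc.desc (Cocone.mk p (Discrete.natTrans z)), hc.hom_ext fun j => ?_⟩
  rw [← Category.assoc, hc.fac, Preadditive.comp_sub]
  exact hz j

theorem preservesColimitsOfShape (hG : IsProjectiveGenerating G) :
    PreservesColimitsOfShape (Discrete ι) G where
  preservesColimit {K} := ⟨fun {c} hc => ⟨IsColimit.ofExistsUnique fun s => by
    obtain ⟨q, π, hπ⟩ := hG.exists_epi s.pt
    choose y hy using fun j => hG.exists_comp_eq π (s.ι.app j)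
    have hfac (j : Discrete ι) : G.map (c.ι.app j) ≫
        G.map (hc.desc (Cocone.mk q (Discrete.natTrans y))) ≫ π = s.ι.app j := by
      rw [← Category.assoc, ← G.map_comp, hc.fac]
      exact hy j
    exact ⟨G.map _ ≫ π, hfac, fun g hg =>
      hG.eq_of_cofan hc fun j => Eq.trans (hg j) (hfac j).symm⟩⟩⟩

/-- A cone with an arbitrary apex is pulled back to a presentation of the apex, where the universal
property in `P` applies; the result kills `f` and so descends. -/
theorem preservesLimitsOfShape (hG : IsProjectiveGenerating G) :
    PreservesLimitsOfShape (Discrete ι) G where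
  preservesLimit {K} := ⟨fun {c} hc => ⟨IsLimit.ofExistsUnique fun s => by
    have := hG.full
    have := hG.faithful
    have := hG.additive
    obtain ⟨p, q, f, π, hπ⟩ := hG.exists_isPresentation s.pt
    have := hπ.epi
    let y (j : Discrete ι) : q ⟶ K.obj j := G.preimage (π ≫ s.π.app j)
    have hy (j : Discrete ι) : G.map (y j) = π ≫ s.π.app j := G.map_preimage _
    let Y : q ⟶ c.pt := hc.lift (Cone.mk q (Discrete.natTrans y))
    have hY (j : Discrete ι) : Y ≫ c.π.app j = y j := hc.fac _ j
    have h0 : f ≫ Y = 0 := hc.hom_ext fun j => G.map_injective (by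
      rw [Category.assoc, hY, zero_comp, G.map_zero, G.map_comp, hy, ← Category.assoc,
        hπ.map_comp, zero_comp])
    obtain ⟨g, hg⟩ := hπ.exists_desc (G.map Y) (by rw [← G.map_comp, h0, G.map_zero])
    have hfac (j : Discrete ι) : g ≫ G.map (c.π.app j) = s.π.app j := by
      rw [← cancel_epi π, ← Category.assoc, hg, ← G.map_comp, hY, hy]
    refine ⟨g, hfac, fun g' hg' => ?_⟩
    rw [← cancel_epi π, hg]
    obtain ⟨Y', hY'⟩ := G.map_surjective (π ≫ g')
    rw [← hY']
    refine congrArg G.map (hc.hom_ext fun j => G.map_injective ?_)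
    rw [hY, hy, G.map_comp, hY', Category.assoc]
    exact congrArg _ (hg' j)⟩⟩

/-- Coproducts commute with cokernels: the coproduct of objects presented by `f j` is the cokernel
of the coproduct of the `f j`, formed in `P`. -/
theorem hasColimitsOfShape (hG : IsProjectiveGenerating G) [HasColimitsOfShape (Discrete ι) P] :
    HasColimitsOfShape (Discrete ι) B where
  has_colimit K := by
    choose p q f π hπ using fun j => hG.exists_isPresentation (K.obj j)
    have (j : Discrete ι) : Epi (π j) := (hπ j).epi
    have hq := hG.preservesColimitsOfShape (ι := ι)
    let Kp : Discrete ι ⥤ P := Discrete.functor fun i => p ⟨i⟩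
    let Kq : Discrete ι ⥤ P := Discrete.functor fun i => q ⟨i⟩
    let a (j : Discrete ι) : p j ⟶ colimit Kp := colimit.ι Kp j
    let b (j : Discrete ι) : q j ⟶ colimit Kq := colimit.ι Kq j
    let F : colimit Kp ⟶ colimit Kq :=
      colimit.desc Kp (Cocone.mk _ (Discrete.natTrans fun j => f j ≫ b j))
    have hF (j : Discrete ι) : a j ≫ F = f j ≫ b j := colimit.ι_desc _ j
    have hd (j : Discrete ι) : ∃ d : K.obj j ⟶ cokernel (G.map F),
        π j ≫ d = G.map (b j) ≫ cokernel.π (G.map F) := (hπ j).exists_desc _ (by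
      rw [← Category.assoc, ← G.map_comp, ← hF, G.map_comp, Category.assoc, cokernel.condition,
        comp_zero])
    choose d hd using hd
    refine ⟨⟨⟨Cocone.mk _ (Discrete.natTrans d), IsColimit.ofExistsUnique fun s => ?_⟩⟩⟩
    let k : G.obj (colimit Kq) ⟶ s.pt := (isColimitOfPreserves G (colimit.isColimit Kq)).desc
      (Cocone.mk s.pt (Discrete.natTrans fun j => π j ≫ s.ι.app j))
    have hk (j : Discrete ι) : G.map (b j) ≫ k = π j ≫ s.ι.app j :=
      (isColimitOfPreserves G (colimit.isColimit Kq)).fac _ j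
    have h0 : G.map F ≫ k = 0 := hG.eq_of_cofan (colimit.isColimit Kp) fun j => by
      refine Eq.trans (b := G.map (a j) ≫ G.map F ≫ k) rfl ?_
      rw [← Category.assoc, ← G.map_comp, hF, G.map_comp, Category.assoc, hk, ← Category.assoc,
        (hπ j).map_comp, zero_comp, comp_zero]
    refine ⟨cokernel.desc _ k h0, fun j => ?_, fun g hg => ?_⟩
    · refine (cancel_epi (π j)).1 (Eq.trans (b := π j ≫ d j ≫ cokernel.desc _ k h0) rfl ?_)
      rw [← Category.assoc, hd, Category.assoc, cokernel.π_desc, hk]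
    · rw [← cancel_epi (cokernel.π (G.map F)), cokernel.π_desc]
      refine hG.eq_of_cofan (colimit.isColimit Kq) fun j => ?_
      refine Eq.trans (b := G.map (b j) ≫ cokernel.π (G.map F) ≫ g) rfl ?_
      refine Eq.trans ?_ (hk j).symm
      rw [← Category.assoc, ← hd, Category.assoc]
      exact congrArg _ (hg j)

end IsProjectiveGenerating

/-! ### Closure under sums and products -/

section Projective

variable {B : Type u₁} [Category.{v₁} B]

instance isClosedUnderColimitsOfShape_isProjective (ι : Type v₂) :
    (isProjective B).IsClosedUnderColimitsOfShape (Discrete ι) where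
  colimitsOfShape_le := by
    rintro Y ⟨p⟩
    have (j : ι) : Projective (p.diag.obj ⟨j⟩) := p.prop_diag_obj _
    exact ⟨fun q e _ ↦ ⟨p.isColimit.desc (Cocone.mk _
      (Discrete.natTrans (fun ⟨j⟩ ↦ (Projective.factorThru (p.ι.app ⟨j⟩ ≫ q) e :)))),
        p.isColimit.hom_ext (fun ⟨j⟩ ↦ by simp [p.isColimit.fac_assoc])⟩⟩

/-- The product formed among projectives is also a product in `B`, so any product in `B` is
isomorphic to a projective object. -/
theorem isClosedUnderLimitsOfShape_isProjective (ι : Type v₂)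
    [HasLimitsOfShape (Discrete ι) (ProjectiveObject B)]
    [PreservesLimitsOfShape (Discrete ι) (isProjective B).ι] :
    (isProjective B).IsClosedUnderLimitsOfShape (Discrete ι) where
  limitsOfShape_le := by
    rintro Y ⟨p⟩
    let K : Discrete ι ⥤ ProjectiveObject B := ObjectProperty.lift _ p.diag p.prop_diag_obj
    exact Projective.of_iso
      ((isLimitOfPreserves (isProjective B).ι (limit.isLimit K)).conePointUniqueUpToIso p.isLimit)
      (limit K).property

end Projective

instance isClosedUnderColimitsOfShape_isInjective {A : Type u} [Category.{v} A] [Abelian A]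
    [IsLocallyNoetherian A] (ι : Type v) :
    (isInjective A).IsClosedUnderColimitsOfShape (Discrete ι) where
  colimitsOfShape_le := by
    rintro Y ⟨p⟩
    have (j : ι) : Injective (p.diag.obj ⟨j⟩) := p.prop_diag_obj _
    have := injective_sigma fun j : ι => p.diag.obj ⟨j⟩
    exact Injective.of_iso ((colimit.isColimit _).coconePointsIsoOfNatIso p.isColimit
      (Discrete.natIsoFunctor (F := p.diag)).symm) this

theorem isProjectiveGenerating_ι {B : Type u₁} [Category.{v₁} B] [Abelian B]
    [EnoughProjectives B] [HasBinaryProducts (ProjectiveObject B)] :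
    IsProjectiveGenerating (isProjective B).ι :=
  isProjectiveGenerating_of_equivalence (CategoryTheory.Equivalence.refl (C := ProjectiveObject B))

section

variable {A : Type u} [Category.{v} A] [Abelian A] [IsLocallyNoetherian A]
  {B : Type u₁} [Category.{v₁} B] [Abelian B] [EnoughProjectives B]

/-- By uniqueness `B` is equivalent to a category of contramodules, where limits are created by the
forgetful functor to sets. -/
theorem hasLimitsOfShape_of_injectiveObject_equivalence
    (e : InjectiveObject A ≌ ProjectiveObject B) (ι : Type v) :
    HasLimitsOfShape (Discrete ι) B := by
  obtain ⟨E, hE⟩ := exists_generatesInjectives A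
  obtain ⟨F, -⟩ := (isProjectiveGenerating_of_equivalence e).exists_equivalence
    (isProjectiveGenerating_of_equivalence hE.functor.asEquivalence)
  exact Adjunction.hasLimitsOfShape_of_equivalence F.functor

theorem isClosedUnderLimitsOfShape_of_injectiveObject_equivalence
    (e : InjectiveObject A ≌ ProjectiveObject B) (ι : Type v) :
    (isProjective B).IsClosedUnderLimitsOfShape (Discrete ι) := by
  have : HasLimitsOfShape (Discrete ι) (ProjectiveObject B) :=
    Adjunction.hasLimitsOfShape_of_equivalence e.inverse
  have : HasBinaryProducts (ProjectiveObject B) :=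
    Adjunction.hasLimitsOfShape_of_equivalence e.inverse
  have := (isProjectiveGenerating_ι (B := B)).preservesLimitsOfShape (ι := ι)
  exact isClosedUnderLimitsOfShape_isProjective ι

end

theorem mainTheorem1 (A : Type u) [Category.{v} A] [Abelian A] [IsLocallyNoetherian A] :
    -- existence of `B`
    (∃ (B : Type (v + 1)) (_ : Category.{v} B) (_ : Abelian B) (_ : EnoughProjectives B)
      (e : InjectiveObject A ≌ ProjectiveObject B), e.functor.Additive) ∧
    -- uniqueness of `B`, compatibly with the identifications of injectives with projectives
    (∀ (B₁ : Type u₁) [Category.{v₁} B₁] [Abelian B₁] [EnoughProjectives B₁]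
      (B₂ : Type u₂) [Category.{v₂} B₂] [Abelian B₂] [EnoughProjectives B₂]
      (e₁ : InjectiveObject A ≌ ProjectiveObject B₁)
      (e₂ : InjectiveObject A ≌ ProjectiveObject B₂),
      ∃ F : B₁ ≌ B₂, F.functor.Additive ∧
        Nonempty (e₁.functor ⋙ (isProjective B₁).ι ⋙ F.functor ≅
          e₂.functor ⋙ (isProjective B₂).ι)) ∧
    -- there is an injective object of which all injectives are summands of sums of copies
    (∃ E : A, GeneratesInjectives E) ∧
    -- for any such `E`, the contramodules over `EndOp E` can be taken as `B`
    (∀ E : A, GeneratesInjectives E →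
      (𝓝 (0 : EndOp E)).HasBasis (fun M : Subobject E => IsNoetherianObject (M : A))
        (fun M => {r | M.arrow ≫ r.hom = 0}) ∧
      ∃ (_ : IsContraRing (EndOp E)) (_ : Abelian (Contramodule (EndOp E))),
        EnoughProjectives (Contramodule (EndOp E)) ∧
        ∃ e : InjectiveObject A ≌ ProjectiveObject (Contramodule (EndOp E)),
          e.functor.Additive) ∧
    -- sums and products in `A`, and closedness of the injectives under them
    (HasCoproducts.{v} A ∧ HasProducts.{v} A ∧
      ∀ ι : Type v, (isInjective A).IsClosedUnderColimitsOfShape (Discrete ι) ∧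
        (isInjective A).IsClosedUnderLimitsOfShape (Discrete ι)) ∧
    -- sums and products in `B`, and closedness of the projectives under them
    (∀ (B : Type u₁) [Category.{v₁} B] [Abelian B] [EnoughProjectives B]
      (_ : InjectiveObject A ≌ ProjectiveObject B),
      HasCoproducts.{v} B ∧ HasProducts.{v} B ∧
      ∀ ι : Type v, (isProjective B).IsClosedUnderColimitsOfShape (Discrete ι) ∧
        (isProjective B).IsClosedUnderLimitsOfShape (Discrete ι)) := by
  refine ⟨?_, fun B₁ _ _ _ B₂ _ _ _ e₁ e₂ => ?_, exists_generatesInjectives A, fun E hE => ?_,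
    ⟨fun ι => inferInstance, fun ι => inferInstance, fun ι => ⟨inferInstance, inferInstance⟩⟩,
    fun B _ _ _ e => ⟨fun ι => ?_, fun ι => hasLimitsOfShape_of_injectiveObject_equivalence e ι,
      fun ι => ⟨inferInstance, isClosedUnderLimitsOfShape_of_injectiveObject_equivalence e ι⟩⟩⟩
  · obtain ⟨E, hE⟩ := exists_generatesInjectives A
    exact ⟨Contramodule (EndOp E), inferInstance, inferInstance, inferInstance,
      hE.functor.asEquivalence, Equivalence.additive_functor _⟩
  · obtain ⟨F, ⟨i⟩⟩ := (isProjectiveGenerating_of_equivalence e₁).exists_equivalence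
      (isProjectiveGenerating_of_equivalence e₂)
    exact ⟨F, F.additive_functor, ⟨i⟩⟩
  · exact ⟨EndOp.hasBasis_nhds_zero, inferInstance, inferInstance, inferInstance,
      hE.functor.asEquivalence, Equivalence.additive_functor _⟩
  · exact (isProjectiveGenerating_of_equivalence e).hasColimitsOfShape
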